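/- Let $\beta,\gamma,\lambda$ be real numbers with $0\le\beta\le\gamma$, $\gamma>0$, $\lambda>0$ and $\beta\gamma<1$. For a finite simple graph $G=(V,E)$, the Gibbs distribution $\mu$ of the antiferromagnetic two-spin system with parameters $(\beta,\gamma,\lambda)$ on $G$ is the probability distribution on $\{0,1\}^V$ with $$\mu(\sigma)\propto \beta^{m_1(\sigma)}\,\gamma^{m_0(\sigma)}\,\lambda^{\|\sigma\|},$$ where $m_b(\sigma)$ is the number of edges both of whose endpoints have spin $b$, $\|\sigma\|$ is the number of vertices of spin $1$, and $0^0=1$. For an integer $d\ge1$ put $f_d(x)=\lambda\left(\frac{\beta x+1}{x+\gamma}\right)^d$ and let $\hat x_d$ be the unique positive fixed point of $f_d$. The triple $(\beta,\gamma,\lambda)$ is called $d$-unique with slack $\delta$ if $$|f_d'(\hat x_d)|=\frac{d(1-\beta\gamma)\hat x_d}{(\beta\hat x_d+1)(\hat x_d+\gamma)}\le 1-\delta .$$ A distribution $\mu$ on $\{0,1\}^V$ is called $C$-coupling independent if for all $\Lambda\subseteq V$ and all $\sigma,\tau\in\{0,1\}^\Lambda$ of positive probability under the marginal of $\mu$ on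 $\Lambda$ that differ at exactly one vertex, $$\inf_{\xi}\ \mathbb E_{(X,Y)\sim\xi}\bigl[\mathrm{dist}(X,Y)\bigr]\le C,$$ where $\mathrm{dist}$ is the Hamming distance on $\{0,1\}^V$ and $\xi$ ranges over all couplings of $\mu^\sigma$ and $\mu^\tau$, the distributions on $\{0,1\}^V$ obtained from $\mu$ by conditioning on the restriction to $\Lambda$ being $\sigma$ and $\tau$, respectively. **Lemma.** Let $\delta\in(0,1)$, and let $G$ be a finite simple graph with maximum degree $\Delta\ge3$. Assume: - if $\gamma\le1$, then $(\beta,\gamma,\lambda)$ is $(\Delta-1)$-unique with slack $\delta$; - if $\gamma>1$, then $(\beta,\gamma,\lambda)$ is $(\Delta-1)$-unique with slack $\delta$, and $G$ is $\Delta$-regular. Then the Gibbs distribution $\mu$ of the two-spin system with parameters $(\beta,\gamma,\lambda)$ on $G$ is $$\left(1+\frac{\Delta(1-\delta)}{(\Delta-1)\,\delta}\right)\text{-coupling independent.}$$ -/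

import Mathlib

open scoped ENNReal

namespace TwoSpin

/-- Parameters `(β, γ, lam)` of an antiferromagnetic two-spin system, normalised so that `β ≤ γ`. -/
structure IsAntiferro (β γ lam : ℝ) : Prop where
  beta_nonneg : 0 ≤ β
  beta_le_gamma : β ≤ γ
  gamma_pos : 0 < γ
  lam_pos : 0 < lam
  mul_lt_one : β * γ < 1

/-! ### The uniqueness condition -/

/-- The univariate tree recursion `x ↦ lam * ((β x + 1) / (x + γ)) ^ d`. -/
noncomputable def treeRec (β γ lam : ℝ) (d : ℕ) (x : ℝ) : ℝ :=
  lam * ((β * x + 1) / (x + γ)) ^ d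

theorem IsAntiferro.treeRec_pos {β γ lam : ℝ} (h : IsAntiferro β γ lam) (d : ℕ) {x : ℝ}
    (hx : 0 ≤ x) : 0 < treeRec β γ lam d x := by
  have h1 := h.beta_nonneg
  have h2 := h.gamma_pos
  have h3 := h.lam_pos
  unfold treeRec
  positivity

theorem IsAntiferro.treeRec_antitone {β γ lam : ℝ} (h : IsAntiferro β γ lam) (d : ℕ) {x y : ℝ}
    (hx : 0 ≤ x) (hxy : x ≤ y) : treeRec β γ lam d y ≤ treeRec β γ lam d x := by
  have h1 := h.beta_nonneg
  have h2 := h.gamma_pos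
  have h3 := h.lam_pos
  have h4 := h.mul_lt_one
  have hy : 0 ≤ y := hx.trans hxy
  unfold treeRec
  gcongr ?_ * ?_ ^ d
  rw [div_le_div_iff₀ (by positivity) (by positivity)]
  nlinarith [mul_nonneg (sub_nonneg.2 hxy) (sub_nonneg.2 h4.le)]

/-- The tree recursion has a unique positive fixed point. -/
theorem IsAntiferro.existsUnique_fixedPoint {β γ lam : ℝ} (h : IsAntiferro β γ lam) (d : ℕ) :
    ∃! x : ℝ, 0 < x ∧ treeRec β γ lam d x = x := by
  set M := treeRec β γ lam d 0 with hM
  have hMpos : 0 < M := h.treeRec_pos d le_rfl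
  have hcont : ContinuousOn (fun x => x - treeRec β γ lam d x) (Set.Icc 0 M) := by
    unfold treeRec
    refine continuousOn_id.sub (continuousOn_const.mul (ContinuousOn.pow ?_ d))
    refine ContinuousOn.div (by fun_prop) (by fun_prop) fun x hx => ?_
    have := h.gamma_pos
    have := hx.1
    positivity
  have hivt := intermediate_value_Icc hMpos.le hcont
  have hmem : (0 : ℝ) ∈ Set.Icc (0 - treeRec β γ lam d 0) (M - treeRec β γ lam d M) :=
    ⟨by linarith, by linarith [h.treeRec_antitone d le_rfl hMpos.le]⟩
  obtain ⟨x, hx, hx0⟩ := hivt hmem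
  have hxf : treeRec β γ lam d x = x := by
    have : x - treeRec β γ lam d x = 0 := hx0
    linarith
  have hxpos : 0 < x := hxf ▸ h.treeRec_pos d hx.1
  refine ⟨x, ⟨hxpos, hxf⟩, ?_⟩
  rintro y ⟨hy, hyf⟩
  rcases le_total x y with hxy | hxy
  · have := h.treeRec_antitone d hxpos.le hxy
    linarith
  · have := h.treeRec_antitone d hy.le hxy
    linarith

/-- The unique positive fixed point of the tree recursion. -/
noncomputable def fixedPoint {β γ lam : ℝ} (h : IsAntiferro β γ lam) (d : ℕ) : ℝ :=
  (h.existsUnique_fixedPoint d).choose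

theorem fixedPoint_pos {β γ lam : ℝ} (h : IsAntiferro β γ lam) (d : ℕ) : 0 < fixedPoint h d :=
  (h.existsUnique_fixedPoint d).choose_spec.1.1

theorem treeRec_fixedPoint {β γ lam : ℝ} (h : IsAntiferro β γ lam) (d : ℕ) :
    treeRec β γ lam d (fixedPoint h d) = fixedPoint h d :=
  (h.existsUnique_fixedPoint d).choose_spec.1.2

/-- `(β, γ, lam)` is `d`-unique with slack `δ`. -/
def IsUnique {β γ lam : ℝ} (h : IsAntiferro β γ lam) (d : ℕ) (δ : ℝ) : Prop :=
  |deriv (treeRec β γ lam d) (fixedPoint h d)| ≤ 1 - δ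

/-- The closed form of the derivative at the fixed point. -/
theorem abs_deriv_treeRec_fixedPoint {β γ lam : ℝ} (h : IsAntiferro β γ lam) (d : ℕ) :
    |deriv (treeRec β γ lam d) (fixedPoint h d)| =
      d * (1 - β * γ) * fixedPoint h d /
        ((β * fixedPoint h d + 1) * (fixedPoint h d + γ)) := by
  have h1 := h.beta_nonneg
  have h2 := h.gamma_pos
  have h4 := h.mul_lt_one
  have hx := fixedPoint_pos h d
  have hf := treeRec_fixedPoint h d
  set x := fixedPoint h d
  have hn : 0 < β * x + 1 := by positivity
  have hd : 0 < x + γ := by positivity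
  have hq : HasDerivAt (fun y : ℝ => (β * y + 1) / (y + γ))
      ((β * (x + γ) - (β * x + 1) * 1) / (x + γ) ^ 2) x := by
    have ha : HasDerivAt (fun y : ℝ => β * y + 1) β x := by
      simpa using ((hasDerivAt_id x).const_mul β).add_const 1
    exact ha.div ((hasDerivAt_id x).add_const γ) hd.ne'
  have hD : HasDerivAt (treeRec β γ lam d) _ x := (hq.pow d).const_mul lam
  have key : deriv (treeRec β γ lam d) x =
      -(d * (1 - β * γ) * x / ((β * x + 1) * (x + γ))) := by
    rw [hD.deriv]
    cases d with
    | zero => simp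
    | succ n =>
      have hf' : lam * ((β * x + 1) / (x + γ)) ^ (n + 1) = x := hf
      have e : x / ((β * x + 1) * (x + γ)) =
          lam * ((β * x + 1) / (x + γ)) ^ n / (x + γ) ^ 2 := by
        nth_rw 1 [← hf']
        rw [pow_succ]
        field_simp
      rw [mul_div_assoc, e]
      simp only [Nat.add_sub_cancel]
      field_simp
      ring
  rw [key, abs_neg, abs_of_nonneg]
  have : 0 ≤ 1 - β * γ := by linarith
  positivity

/-! ### The Gibbs distribution -/

section Gibbs

variable {V : Type*} [Fintype V] [DecidableEq V] (G : SimpleGraph V) [DecidableRel G.Adj]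

/-- The number of edges both of whose endpoints have spin `b` (spin `1` is `true`). -/
def monoEdges (b : Bool) (σ : V → Bool) : ℕ :=
  (G.edgeFinset.filter fun e => ∀ v ∈ e, σ v = b).card

/-- The number of vertices with spin `1`. -/
def onesCount (σ : V → Bool) : ℕ := (Finset.univ.filter fun v => σ v = true).card

/-- The unnormalised weight of a configuration. -/
def weight (β γ lam : ℝ) (σ : V → Bool) : ℝ :=
  β ^ monoEdges G true σ * γ ^ monoEdges G false σ * lam ^ onesCount σ

theorem tsum_weight_ne_zero {β γ lam : ℝ} (h : IsAntiferro β γ lam) :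
    ∑' σ : V → Bool, ENNReal.ofReal (weight G β γ lam σ) ≠ 0 := by
  intro h0
  have h1 := ENNReal.tsum_eq_zero.1 h0 fun _ => false
  rw [ENNReal.ofReal_eq_zero] at h1
  refine absurd h1 (not_le.2 ?_)
  have hm : monoEdges G true (fun _ : V => false) = 0 := by
    rw [monoEdges, Finset.card_eq_zero, Finset.filter_eq_empty_iff]
    intro e _ he
    induction e using Sym2.ind with
    | _ a b => simpa using he a (by simp)
  have h2 := h.gamma_pos
  have h3 := h.lam_pos
  rw [weight, hm, pow_zero]
  positivity

theorem tsum_weight_ne_top (β γ lam : ℝ) :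
    ∑' σ : V → Bool, ENNReal.ofReal (weight G β γ lam σ) ≠ ∞ := by
  rw [tsum_fintype]
  exact ENNReal.sum_ne_top.2 fun _ _ => ENNReal.ofReal_ne_top

/-- The Gibbs distribution of the antiferromagnetic two-spin system on `G`. -/
noncomputable def gibbs {β γ lam : ℝ} (h : IsAntiferro β γ lam) : PMF (V → Bool) :=
  PMF.normalize (fun σ => ENNReal.ofReal (weight G β γ lam σ))
    (tsum_weight_ne_zero G h) (tsum_weight_ne_top G β γ lam)

end Gibbs

/-! ### Coupling independence -/

section Coupling

variable {V : Type*}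

/-- The marginal of `μ` on `Λ`. Its support is the set of feasible pinnings on `Λ`. -/
noncomputable def marginal (μ : PMF (V → Bool)) (Λ : Finset V) : PMF (Λ → Bool) :=
  μ.map Λ.restrict

theorem exists_mem_support_of_feasible {μ : PMF (V → Bool)} {Λ : Finset V} {σ : Λ → Bool}
    (hσ : σ ∈ (marginal μ Λ).support) :
    ∃ X ∈ {X : V → Bool | Λ.restrict X = σ}, X ∈ μ.support := by
  obtain ⟨X, hX, hXσ⟩ := (PMF.mem_support_map_iff _ _ _).1 hσ
  exact ⟨X, hXσ, hX⟩

/-- The distribution of `X ∼ μ` conditioned on `X` agreeing with the feasible pinning `σ` on `Λ`. -/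
noncomputable def pinned (μ : PMF (V → Bool)) {Λ : Finset V} {σ : Λ → Bool}
    (hσ : σ ∈ (marginal μ Λ).support) : PMF (V → Bool) :=
  μ.filter {X | Λ.restrict X = σ} (exists_mem_support_of_feasible hσ)

/-- `ξ` is a coupling of `μ` and `ν`. -/
def IsCoupling {α : Type*} (μ ν : PMF α) (ξ : PMF (α × α)) : Prop :=
  ξ.map Prod.fst = μ ∧ ξ.map Prod.snd = ν

/-- The expected Hamming distance of a pair drawn from `ξ`. -/
noncomputable def expectedDist [Fintype V] (ξ : PMF ((V → Bool) × (V → Bool))) : ℝ≥0∞ :=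
  ∑' p : (V → Bool) × (V → Bool), ξ p * (hammingDist p.1 p.2 : ℝ≥0∞)

/-- `μ` is `C`-coupling independent. -/
def CouplingIndependent [Fintype V] (μ : PMF (V → Bool)) (C : ℝ) : Prop :=
  ∀ (Λ : Finset V) (σ τ : Λ → Bool) (hσ : σ ∈ (marginal μ Λ).support)
    (hτ : τ ∈ (marginal μ Λ).support), hammingDist σ τ = 1 →
    (⨅ (ξ : PMF ((V → Bool) × (V → Bool))) (_ : IsCoupling (pinned μ hσ) (pinned μ hτ) ξ),
      expectedDist ξ) ≤ ENNReal.ofReal C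

end Coupling

end TwoSpin

/-!
The proof couples the two pinned distributions recursively along the edges leaving the vertex `v`
at which the pinnings differ, and controls the cost by a potential function of the marginal ratio.

Remove `v` and give each of its neighbours `u` a private copy of `v`. Switching the copies from spin
`0` to spin `1` one at a time telescopes both sides of the problem with the same numbers. If `y u`
is the marginal ratio (weight of spin `1` over weight of spin `0`) of `u` when its own copy is
dropped, then switching that copy multiplies the partition function by `(β y + 1) / (y + γ)`, and
moves the law of the spin of `u` by `influence y = (1 - β γ) y / ((β y + 1) (y + γ))`. Hence the
ratio of `v` obeys the tree recursion in the `y u`, and the cost at `v` is at most one plus the sum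
over `u` of `influence (y u)` times the cost at `u` in a system with fewer edges (`exists_ratios`).
Couplings are handled as real mass functions (`TransportBound`), so that mixtures are sums and the
telescoping is the gluing lemma `TransportBound.trans`.

It remains to find a function of the ratio that dominates the cost of flipping a vertex with at most
`d = Δ - 1` neighbours. Let `x` be the fixed point of the tree recursion, `r` the logarithmic
derivative of the influence at `x`, and `s(y) = log ((y + γ) / (β y + 1))`. The function
`K (1 + min 0 (-r log (y / x)))` with `K = 1 / (1 - d * influence x)` works, because
`influence y * (1 + min 0 (-r log (y / x))) ≤ influence x + min 0 (r (s(y) - s(x)))`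
(`IsAntiferro.influence_mul_potential_le`). On one side of `x` this holds because the influence is a
concave function of `s`, on the other because it is a log-concave function of `log y`. The right
side is an envelope which is concave in `s`, and `s` is additive under the tree recursion, so
summing over at most `d` children gives back the potential at the parent
(`IsAntiferro.sum_envelope_le`). A missing child is padded by a child with `s = 0`, where the
envelope is nonnegative if `γ ≤ 1`; for `γ > 1` regularity means that no child is missing.

Finally, the envelope never exceeds `influence x ≤ (1 - δ) / d`, so the `Δ` neighbours of the vertex
`v` contribute at most `Δ K (1 - δ) / d ≤ Δ (1 - δ) / ((Δ - 1) δ)`.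
-/

open scoped ENNReal

namespace TwoSpin

/-! ### Transport between finite mass functions -/

section Transport

variable {V : Type*} [Fintype V]

/-- There is a coupling `ξ` of the mass functions `p` and `q` on spin configurations under which
the expected Hamming distance is at most `C`. The mass functions need not be normalised, which
makes the notion additive and homogeneous in `(p, q, C)`. -/
def TransportBound [DecidableEq V] (p q : (V → Bool) → ℝ) (C : ℝ) : Prop :=
  ∃ ξ : (V → Bool) → (V → Bool) → ℝ, (∀ x y, 0 ≤ ξ x y) ∧ (∀ x, ∑ y, ξ x y = p x) ∧
    (∀ y, ∑ x, ξ x y = q y) ∧ ∑ x, ∑ y, ξ x y * (hammingDist x y : ℝ) ≤ C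

/-- The probability mass function proportional to the weight `w`; it is zero if `w` has total zero. -/
noncomputable def normalized [DecidableEq V] (w : (V → Bool) → ℝ) : (V → Bool) → ℝ :=
  fun x => w x / ∑ y, w y

namespace TransportBound

variable [DecidableEq V] {p q p' q' : (V → Bool) → ℝ} {C C' : ℝ}

theorem mono (h : TransportBound p q C) (hC : C ≤ C') : TransportBound p q C' := by
  obtain ⟨ξ, h0, h1, h2, h3⟩ := h
  exact ⟨ξ, h0, h1, h2, h3.trans hC⟩

theorem symm (h : TransportBound p q C) : TransportBound q p C := by
  obtain ⟨ξ, h0, h1, h2, h3⟩ := h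
  refine ⟨fun x y => ξ y x, fun x y => h0 y x, h2, h1, ?_⟩
  rw [Finset.sum_comm]
  simpa only [hammingDist_comm] using h3

theorem add (h : TransportBound p q C) (h' : TransportBound p' q' C') :
    TransportBound (p + p') (q + q') (C + C') := by
  obtain ⟨ξ, h0, h1, h2, h3⟩ := h
  obtain ⟨ξ', h0', h1', h2', h3'⟩ := h'
  refine ⟨fun x y => ξ x y + ξ' x y, fun x y => add_nonneg (h0 x y) (h0' x y), fun x => ?_,
    fun y => ?_, ?_⟩
  · simp [Finset.sum_add_distrib, h1, h1']
  · simp [Finset.sum_add_distrib, h2, h2']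
  · simp only [add_mul, Finset.sum_add_distrib]
    exact add_le_add h3 h3'

theorem smul {a : ℝ} (ha : 0 ≤ a) (h : TransportBound p q C) :
    TransportBound (a • p) (a • q) (a * C) := by
  obtain ⟨ξ, h0, h1, h2, h3⟩ := h
  refine ⟨fun x y => a * ξ x y, fun x y => mul_nonneg ha (h0 x y), fun x => ?_,
    fun y => ?_, ?_⟩
  · simp [← Finset.mul_sum, h1]
  · simp [← Finset.mul_sum, h2]
  · simp only [mul_assoc, ← Finset.mul_sum]
    exact mul_le_mul_of_nonneg_left h3 ha

/-- Transport along a map moving every configuration by at most one spin. -/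
theorem comp_involutive (hp : ∀ x, 0 ≤ p x) (hm : ∑ x, p x ≤ 1)
    {f : (V → Bool) → (V → Bool)} (hf : Function.Involutive f)
    (hd : ∀ x, hammingDist x (f x) ≤ 1) : TransportBound p (p ∘ f) 1 := by
  refine ⟨fun x y => if y = f x then p x else 0, fun x y => ?_, fun x => ?_, fun y => ?_, ?_⟩
  · dsimp only
    split_ifs
    exacts [hp x, le_rfl]
  · simp
  · have : ∀ x, (y = f x) ↔ (x = f y) := fun x =>
      ⟨fun h => by rw [h, hf], fun h => by rw [h, hf]⟩
    simp [this]
  · refine le_trans (Finset.sum_le_sum fun x _ => ?_) hm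
    simp only [ite_mul, zero_mul, Finset.sum_ite_eq', Finset.mem_univ, if_true]
    have : (hammingDist x (f x) : ℝ) ≤ 1 := by exact_mod_cast hd x
    nlinarith [hp x]

theorem refl (hp : ∀ x, 0 ≤ p x) : TransportBound p p 0 := by
  refine ⟨fun x y => if y = x then p x else 0, fun x y => ?_, fun x => ?_, fun y => ?_, ?_⟩
  · dsimp only
    split_ifs
    exacts [hp x, le_rfl]
  · simp
  · simp
  · simp

/-- The triangle inequality, obtained by gluing two couplings along their common marginal. -/
theorem trans {r : (V → Bool) → ℝ} (h : TransportBound p q C) (h' : TransportBound q r C') :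
    TransportBound p r (C + C') := by
  obtain ⟨ξ, h0, h1, h2, h3⟩ := h
  obtain ⟨ξ', h0', h1', h2', h3'⟩ := h'
  have hq : ∀ y, 0 ≤ q y := fun y => h2 y ▸ Finset.sum_nonneg fun x _ => h0 x y
  -- Where `q` vanishes both couplings do, so the division by `q y` loses no mass.
  have hl : ∀ x y, ξ x y / q y * q y = ξ x y := fun x y => by
    by_cases hy : q y = 0
    · have := (Finset.sum_eq_zero_iff_of_nonneg fun x _ => h0 x y).1 ((h2 y).trans hy) x
        (Finset.mem_univ x)
      rw [this]; simp
    · field_simp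
  have hr : ∀ y z, q y * (ξ' y z / q y) = ξ' y z := fun y z => by
    by_cases hy : q y = 0
    · have := (Finset.sum_eq_zero_iff_of_nonneg fun z _ => h0' y z).1 ((h1' y).trans hy) z
        (Finset.mem_univ z)
      rw [this]; simp
    · field_simp
  have hz : ∀ x y, ∑ z, ξ x y * ξ' y z / q y = ξ x y := fun x y => by
    rw [← Finset.sum_div, ← Finset.mul_sum, h1', mul_div_right_comm, hl]
  have hx : ∀ y z, ∑ x, ξ x y * ξ' y z / q y = ξ' y z := fun y z => by
    rw [← Finset.sum_div, ← Finset.sum_mul, h2, mul_div_assoc, hr]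
  refine ⟨fun x z => ∑ y, ξ x y * ξ' y z / q y, fun x z => Finset.sum_nonneg fun y _ =>
    div_nonneg (mul_nonneg (h0 x y) (h0' y z)) (hq y), fun x => ?_, fun z => ?_, ?_⟩
  · rw [Finset.sum_comm]
    simp only [hz, h1]
  · rw [Finset.sum_comm]
    simp only [hx, h2']
  · have e1 : ∑ x, ∑ y, ξ x y * (hammingDist x y : ℝ) =
        ∑ x, ∑ z, ∑ y, ξ x y * ξ' y z / q y * (hammingDist x y : ℝ) := by
      refine Finset.sum_congr rfl fun x _ => ?_
      rw [Finset.sum_comm]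
      refine Finset.sum_congr rfl fun y _ => ?_
      rw [← Finset.sum_mul, hz]
    have e2 : ∑ y, ∑ z, ξ' y z * (hammingDist y z : ℝ) =
        ∑ x, ∑ z, ∑ y, ξ x y * ξ' y z / q y * (hammingDist y z : ℝ) := by
      rw [Finset.sum_comm (s := (Finset.univ : Finset (V → Bool)))
        (f := fun x z => ∑ y, ξ x y * ξ' y z / q y * (hammingDist y z : ℝ)), Finset.sum_comm]
      refine Finset.sum_congr rfl fun z _ => ?_
      rw [Finset.sum_comm]
      refine Finset.sum_congr rfl fun y _ => ?_
      rw [← Finset.sum_mul, hx]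
    refine le_trans ?_ (add_le_add (e1 ▸ h3) (e2 ▸ h3'))
    simp only [← Finset.sum_add_distrib, ← mul_add, Finset.sum_mul]
    gcongr with x _ z _ y _
    · exact div_nonneg (mul_nonneg (h0 x y) (h0' y z)) (hq y)
    · exact_mod_cast hammingDist_triangle x y z

end TransportBound

end Transport

/-! ### The one-edge influence and its envelope -/

section Analysis

/-- The influence on a neighbour whose marginal ratio is `y`: the difference of its two
probabilities of spin `1` when the spin at the other end of the edge is flipped. -/
noncomputable def influence (β γ y : ℝ) : ℝ := (1 - β * γ) * y / ((β * y + 1) * (y + γ))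

/-- Minus the logarithm of the factor `(β y + 1) / (y + γ)` that a child with marginal ratio `y`
contributes to the tree recursion. -/
noncomputable def edgeLog (β γ y : ℝ) : ℝ := Real.log ((y + γ) / (β * y + 1))

/-- The logarithmic derivative `d log (influence) / d log y`. -/
noncomputable def influenceSlope (β γ y : ℝ) : ℝ :=
  1 - y / (y + γ) - β * y / (β * y + 1)

/-- The influence as a function of the coordinate `s = edgeLog`. -/
noncomputable def influenceLog (β γ s : ℝ) : ℝ :=
  (1 + β * γ - γ * Real.exp (-s) - β * Real.exp s) / (1 - β * γ)

variable {β γ lam : ℝ}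

theorem IsAntiferro.influence_nonneg (h : IsAntiferro β γ lam) {y : ℝ} (hy : 0 ≤ y) :
    0 ≤ influence β γ y := by
  have h1 := h.beta_nonneg
  have h2 := h.gamma_pos
  have h4 : 0 ≤ 1 - β * γ := by linarith [h.mul_lt_one]
  unfold influence
  positivity

theorem IsAntiferro.influenceLog_edgeLog (h : IsAntiferro β γ lam) {y : ℝ} (hy : 0 ≤ y) :
    influenceLog β γ (edgeLog β γ y) = influence β γ y := by
  have h1 := h.beta_nonneg
  have h2 := h.gamma_pos
  have h4 : 0 < 1 - β * γ := by linarith [h.mul_lt_one]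
  have hp : 0 < y + γ := by positivity
  have hq : 0 < β * y + 1 := by positivity
  unfold influenceLog edgeLog influence
  rw [Real.exp_neg, Real.exp_log (by positivity)]
  field_simp
  ring

/-- In the coordinate `s` the influence is concave: it lies below its tangents. -/
theorem IsAntiferro.influenceLog_le (h : IsAntiferro β γ lam) {x : ℝ} (hx : 0 ≤ x) (s : ℝ) :
    influenceLog β γ s ≤
      influence β γ x + influenceSlope β γ x * (s - edgeLog β γ x) := by
  have h1 := h.beta_nonneg
  have h2 := h.gamma_pos
  have h4 : 0 < 1 - β * γ := by linarith [h.mul_lt_one]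
  have hp : 0 < x + γ := by positivity
  have hq : 0 < β * x + 1 := by positivity
  set s₀ := edgeLog β γ x with hs₀
  have hE : Real.exp s₀ = (x + γ) / (β * x + 1) := Real.exp_log (by positivity)
  have hr : influenceSlope β γ x =
      (γ * Real.exp (-s₀) - β * Real.exp s₀) / (1 - β * γ) := by
    rw [Real.exp_neg, hE, influenceSlope, eq_div_iff h4.ne']
    field_simp
    ring
  have e1 : Real.exp s₀ * (1 + (s - s₀)) ≤ Real.exp s := by
    have := mul_le_mul_of_nonneg_left (Real.add_one_le_exp (s - s₀)) (Real.exp_pos s₀).le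
    rw [← Real.exp_add] at this
    simpa [add_comm] using this
  have e2 : Real.exp (-s₀) * (1 - (s - s₀)) ≤ Real.exp (-s) := by
    have := mul_le_mul_of_nonneg_left (Real.add_one_le_exp (-(s - s₀))) (Real.exp_pos (-s₀)).le
    rw [← Real.exp_add] at this
    have e : -s₀ + -(s - s₀) = -s := by ring
    rw [e] at this
    linarith
  rw [← h.influenceLog_edgeLog hx, hr, influenceLog, influenceLog, ← hs₀, div_mul_eq_mul_div,
    ← add_div]
  apply div_le_div_of_nonneg_right _ h4.le
  nlinarith [mul_le_mul_of_nonneg_left e1 h1, mul_le_mul_of_nonneg_left e2 h2.le]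

/-- Concavity of the logarithm between `1` and `z`. -/
theorem mul_log_le_log_affine {q z : ℝ} (hq0 : 0 ≤ q) (hq1 : q ≤ 1) (hz : 0 < z) :
    q * Real.log z ≤ Real.log (1 - q + q * z) := by
  have := strictConcaveOn_log_Ioi.concaveOn.2 (Set.mem_Ioi.2 one_pos) (Set.mem_Ioi.2 hz)
    (sub_nonneg.2 hq1) hq0 (by ring)
  simpa using this

/-- In the coordinate `log y` the influence is log-concave. -/
theorem IsAntiferro.influence_le (h : IsAntiferro β γ lam) {x y : ℝ} (hx : 0 < x) (hy : 0 < y) :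
    influence β γ y ≤
      influence β γ x * Real.exp (influenceSlope β γ x * Real.log (y / x)) := by
  have h1 := h.beta_nonneg
  have h2 := h.gamma_pos
  have h4 : 0 < 1 - β * γ := by linarith [h.mul_lt_one]
  have hp : 0 < x + γ := by positivity
  have hq : 0 < β * x + 1 := by positivity
  have hp' : 0 < y + γ := by positivity
  have hq' : 0 < β * y + 1 := by positivity
  have hz : 0 < y / x := by positivity
  have a1 := mul_log_le_log_affine (q := x / (x + γ)) (by positivity)
    ((div_le_one hp).2 (by linarith)) hz
  have a2 := mul_log_le_log_affine (q := β * x / (β * x + 1)) (by positivity)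
    ((div_le_one hq).2 (by linarith)) hz
  have b1 : 1 - x / (x + γ) + x / (x + γ) * (y / x) = (y + γ) / (x + γ) := by
    field_simp; ring
  have b2 : 1 - β * x / (β * x + 1) + β * x / (β * x + 1) * (y / x) =
      (β * y + 1) / (β * x + 1) := by
    field_simp; ring
  rw [b1] at a1
  rw [b2] at a2
  have key : influence β γ y = influence β γ x *
      Real.exp (Real.log (y / x) - Real.log ((y + γ) / (x + γ)) -
        Real.log ((β * y + 1) / (β * x + 1))) := by
    rw [Real.exp_sub, Real.exp_sub, Real.exp_log hz, Real.exp_log (by positivity),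
      Real.exp_log (by positivity), influence, influence]
    field_simp
  rw [key]
  have := h.influence_nonneg hx.le
  gcongr
  unfold influenceSlope
  linarith

theorem IsAntiferro.edgeLog_mono (h : IsAntiferro β γ lam) {x y : ℝ} (hx : 0 ≤ x)
    (hxy : x ≤ y) : edgeLog β γ x ≤ edgeLog β γ y := by
  have h1 := h.beta_nonneg
  have h2 := h.gamma_pos
  have h4 : 0 ≤ 1 - β * γ := by linarith [h.mul_lt_one]
  have hy := hx.trans hxy
  unfold edgeLog
  apply Real.log_le_log (by positivity)
  rw [div_le_div_iff₀ (by positivity) (by positivity)]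
  nlinarith [mul_nonneg (sub_nonneg.2 hxy) h4]

/-- The potential dominating the total influence of a vertex with marginal ratio `y`, normalised
to equal `1` at the reference point `x`. -/
noncomputable def potential (β γ x y : ℝ) : ℝ :=
  1 + min 0 (-(influenceSlope β γ x * Real.log (y / x)))

/-- The bound, concave in `s = edgeLog`, on the contribution of one child to the potential. -/
noncomputable def envelope (β γ x s : ℝ) : ℝ :=
  influence β γ x + min 0 (influenceSlope β γ x * (s - edgeLog β γ x))

theorem envelope_le (β γ x s : ℝ) : envelope β γ x s ≤ influence β γ x := by
  unfold envelope
  linarith [min_le_left 0 (influenceSlope β γ x * (s - edgeLog β γ x))]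

theorem IsAntiferro.envelope_nonneg (h : IsAntiferro β γ lam) {x : ℝ} (hx : 0 ≤ x) {s : ℝ}
    (hs : 0 ≤ influenceLog β γ s) : 0 ≤ envelope β γ x s := by
  have h1 := h.influence_nonneg hx
  have h2 := h.influenceLog_le hx s
  unfold envelope
  rcases min_cases 0 (influenceSlope β γ x * (s - edgeLog β γ x)) with ⟨e, -⟩ | ⟨e, -⟩ <;>
    rw [e] <;> linarith

/-- A child of ratio `y` contributes at most the envelope. On the side of `x` where the potential
is `1` this is concavity in `s`, on the other side it is log-concavity in `log y`. -/
theorem IsAntiferro.influence_mul_potential_le (h : IsAntiferro β γ lam) {x y : ℝ} (hx : 0 < x)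
    (hy : 0 < y) :
    influence β γ y * potential β γ x y ≤ envelope β γ x (edgeLog β γ y) := by
  have hn := h.influence_nonneg hy.le
  have hn' := h.influence_nonneg hx.le
  set r := influenceSlope β γ x with hr
  -- `edgeLog y - edgeLog x` and `log (y / x)` have the same sign
  have hsign : 0 ≤ (edgeLog β γ y - edgeLog β γ x) * Real.log (y / x) := by
    rcases le_total x y with hxy | hxy
    · exact mul_nonneg (sub_nonneg.2 (h.edgeLog_mono hx.le hxy))
        (Real.log_nonneg ((one_le_div hx).2 hxy))
    · exact mul_nonneg_of_nonpos_of_nonpos (sub_nonpos.2 (h.edgeLog_mono hy.le hxy))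
        (Real.log_nonpos (by positivity) ((div_le_one hx).2 hxy))
  unfold potential envelope
  rw [← hr]
  have hc := h.influenceLog_le hx.le (edgeLog β γ y)
  rw [h.influenceLog_edgeLog hy.le, ← hr] at hc
  rcases le_or_gt (r * Real.log (y / x)) 0 with ht | ht
  · rw [min_eq_left (by linarith)]
    have : influence β γ y ≤ influence β γ x := by
      have := h.influence_le hx hy
      rw [← hr] at this
      exact this.trans (mul_le_of_le_one_right hn' (Real.exp_le_one_iff.2 ht))
    rcases min_cases 0 (r * (edgeLog β γ y - edgeLog β γ x)) with ⟨e, -⟩ | ⟨e, -⟩ <;>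
      rw [e] <;> linarith
  · have hs : 0 ≤ r * (edgeLog β γ y - edgeLog β γ x) := by
      by_contra! hneg
      have := mul_neg_of_neg_of_pos hneg ht
      nlinarith [mul_nonneg (sq_nonneg r) hsign]
    rw [min_eq_left hs, min_eq_right (by linarith), add_zero]
    have := h.influence_le hx hy
    rw [← hr] at this
    set t := r * Real.log (y / x)
    have e1 : 1 + -t ≤ Real.exp (-t) := by linarith [Real.add_one_le_exp (-t)]
    calc influence β γ y * (1 + -t) ≤ influence β γ y * Real.exp (-t) := by gcongr
      _ ≤ influence β γ x * Real.exp t * Real.exp (-t) := by gcongr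
      _ = influence β γ x := by rw [mul_assoc, ← Real.exp_add]; simp

/-- A child fixed to spin `0` contributes `s = log γ`, where the influence vanishes. -/
theorem IsAntiferro.influenceLog_log_gamma (h : IsAntiferro β γ lam) :
    influenceLog β γ (Real.log γ) = 0 := by
  have := h.gamma_pos
  rw [influenceLog, Real.exp_neg, Real.exp_log this]
  field_simp
  simp

/-- A child fixed to spin `1` contributes `s = -log β`, where the influence vanishes. -/
theorem influenceLog_neg_log_beta (hβ : 0 < β) :
    influenceLog β γ (-Real.log β) = 0 := by
  rw [influenceLog, neg_neg, Real.exp_neg, Real.exp_log hβ]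
  field_simp
  simp

/-- A missing child contributes `s = 0`. -/
theorem IsAntiferro.influenceLog_zero_nonneg (h : IsAntiferro β γ lam) (hγ : γ ≤ 1) :
    0 ≤ influenceLog β γ 0 := by
  have h4 : 0 < 1 - β * γ := by linarith [h.mul_lt_one]
  have := h.beta_le_gamma
  rw [influenceLog]
  apply div_nonneg _ h4.le
  simp
  nlinarith

theorem IsAntiferro.exp_neg_edgeLog (h : IsAntiferro β γ lam) {y : ℝ} (hy : 0 ≤ y) :
    Real.exp (-edgeLog β γ y) = (β * y + 1) / (y + γ) := by
  have h1 := h.beta_nonneg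
  have h2 := h.gamma_pos
  rw [edgeLog, Real.exp_neg, Real.exp_log (by positivity), inv_div]

theorem IsAntiferro.influence_mul_potential_le_of_nonneg (h : IsAntiferro β γ lam) {x y : ℝ}
    (hx : 0 < x) (hy : 0 ≤ y) :
    influence β γ y * potential β γ x y ≤ envelope β γ x (edgeLog β γ y) := by
  rcases hy.eq_or_lt with rfl | hy
  · have : influence β γ 0 = 0 := by simp [influence]
    rw [this, zero_mul]
    exact h.envelope_nonneg hx.le (by rw [h.influenceLog_edgeLog le_rfl, this])
  · exact h.influence_mul_potential_le hx hy

/-- The envelope inequality summed over the children of a vertex of ratio `z`: here `k₁`, `k₀`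
children are already fixed to the spins `1` and `0`, and at most `d` children are present. Missing
children are padded with the factor `1`, which is where `γ ≤ 1` or exact regularity is needed. -/
theorem IsAntiferro.sum_envelope_le {V : Type*} (h : IsAntiferro β γ lam) {d : ℕ} {x : ℝ}
    (hx : 0 < x)
    (hfix : treeRec β γ lam d x = x) (hd : d * influence β γ x < 1) {N : Finset V}
    {k₁ k₀ : ℕ} {y : V → ℝ} (hy : ∀ u, 0 ≤ y u) (hle : N.card + k₁ + k₀ ≤ d)
    (heq : 1 < γ → N.card + k₁ + k₀ = d)
    {z : ℝ} (hz : 0 < z)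
    (hzy : z = lam * β ^ k₁ / γ ^ k₀ * ∏ u ∈ N, (β * y u + 1) / (y u + γ)) :
    1 + (1 - d * influence β γ x)⁻¹ * ∑ u ∈ N, envelope β γ x (edgeLog β γ (y u)) ≤
      (1 - d * influence β γ x)⁻¹ * potential β γ x z := by
  have h2 := h.gamma_pos
  have h3 := h.lam_pos
  have hK : 0 < (1 - d * influence β γ x)⁻¹ := inv_pos.2 (by linarith)
  have hI := h.influence_nonneg hx.le
  set ι := influence β γ x with hι
  set r := influenceSlope β γ x with hr
  set s₀ := edgeLog β γ x with hs₀
  obtain ⟨m, hm⟩ := Nat.exists_eq_add_of_le hle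
  have hmR : (d : ℝ) = N.card + k₁ + k₀ + m := by exact_mod_cast hm
  -- the logarithm of the recursion at `z` and at the fixed point
  -- `β = 0` is allowed, but then `z > 0` forces `k₁ = 0`
  have hβk : β ^ k₁ ≠ 0 := fun h0 => by
    rw [hzy, h0] at hz
    simp at hz
  have hlz : Real.log z = Real.log lam + k₁ * Real.log β - k₀ * Real.log γ -
      ∑ u ∈ N, edgeLog β γ (y u) := by
    rw [hzy, Finset.prod_congr rfl fun u _ => (h.exp_neg_edgeLog (hy u)).symm, ← Real.exp_sum,
      Real.log_mul (by positivity) (Real.exp_pos _).ne', Real.log_exp,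
      Real.log_div (by positivity) (by positivity), Real.log_mul h3.ne' hβk, Real.log_pow,
      Real.log_pow, Finset.sum_neg_distrib]
    ring
  have hlx : Real.log x = Real.log lam - d * s₀ := by
    conv_lhs => rw [← hfix]
    rw [treeRec, ← h.exp_neg_edgeLog hx.le, ← Real.exp_nat_mul,
      Real.log_mul h3.ne' (Real.exp_pos _).ne', Real.log_exp]
    ring
  have hlog : Real.log (z / x) = d * s₀ - (∑ u ∈ N, edgeLog β γ (y u) +
      k₁ * (-Real.log β) + k₀ * Real.log γ) := by
    rw [Real.log_div hz.ne' hx.ne', hlz, hlx]; ring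
  -- two bounds on the envelope, and its sign at the fixed and at the missing children
  have b1 : ∀ s, envelope β γ x s ≤ ι := envelope_le β γ x
  have b2 : ∀ s, envelope β γ x s ≤ ι + r * (s - s₀) := fun s => by
    unfold envelope
    linarith [min_le_right 0 (influenceSlope β γ x * (s - edgeLog β γ x))]
  have n1 : 0 ≤ (k₁ : ℝ) * envelope β γ x (-Real.log β) := by
    rcases Nat.eq_zero_or_pos k₁ with h0 | h0
    · simp [h0]
    · have hβ : 0 < β := lt_of_le_of_ne h.beta_nonneg fun h0' => hβk (by
        rw [← h0', zero_pow h0.ne'])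
      exact mul_nonneg k₁.cast_nonneg
        (h.envelope_nonneg hx.le (influenceLog_neg_log_beta hβ).ge)
  have n0 : 0 ≤ (k₀ : ℝ) * envelope β γ x (Real.log γ) :=
    mul_nonneg k₀.cast_nonneg (h.envelope_nonneg hx.le h.influenceLog_log_gamma.ge)
  have nm : 0 ≤ (m : ℝ) * envelope β γ x 0 := by
    rcases le_or_gt γ 1 with hγ | hγ
    · exact mul_nonneg m.cast_nonneg
        (h.envelope_nonneg hx.le (h.influenceLog_zero_nonneg hγ))
    · have : m = 0 := by have := heq hγ; omega
      simp [this]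
  have key : ∑ u ∈ N, envelope β γ x (edgeLog β γ (y u)) ≤
      d * ι + min 0 (-(r * Real.log (z / x))) := by
    rw [← sub_le_iff_le_add']
    refine le_min ?_ ?_
    · have : ∑ u ∈ N, envelope β γ x (edgeLog β γ (y u)) ≤ N.card * ι := by
        simpa using Finset.sum_le_sum fun u (_ : u ∈ N) => b1 (edgeLog β γ (y u))
      have hc : (N.card : ℝ) ≤ d := by exact_mod_cast (by omega : N.card ≤ d)
      linarith [mul_le_mul_of_nonneg_right hc hI]
    · have h0 : ∑ u ∈ N, envelope β γ x (edgeLog β γ (y u)) ≤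
          N.card * ι + r * (∑ u ∈ N, edgeLog β γ (y u) - N.card * s₀) := by
        have := Finset.sum_le_sum fun u (_ : u ∈ N) => b2 (edgeLog β γ (y u))
        rw [Finset.sum_add_distrib, ← Finset.mul_sum, Finset.sum_sub_distrib] at this
        simpa using this
      have c1 := mul_le_mul_of_nonneg_left (b2 (-Real.log β)) (Nat.cast_nonneg (α := ℝ) k₁)
      have c0 := mul_le_mul_of_nonneg_left (b2 (Real.log γ)) (Nat.cast_nonneg (α := ℝ) k₀)
      have cm := mul_le_mul_of_nonneg_left (b2 0) (Nat.cast_nonneg (α := ℝ) m)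
      rw [hlog, hmR]
      linarith
  have hKd : 1 + (1 - d * ι)⁻¹ * (d * ι) = (1 - d * ι)⁻¹ := by
    have : 1 - d * ι ≠ 0 := by linarith
    field_simp
    ring
  calc 1 + (1 - d * ι)⁻¹ * ∑ u ∈ N, envelope β γ x (edgeLog β γ (y u))
      ≤ 1 + (1 - d * ι)⁻¹ * (d * ι + min 0 (-(r * Real.log (z / x)))) := by gcongr
    _ = (1 - d * ι)⁻¹ * potential β γ x z := by
      rw [potential, ← hr, mul_add, ← add_assoc, hKd]; ring

end Analysis

/-! ### Weights with vertex fields -/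

section Systems

/-- The interaction of two adjacent spins. -/
def edgeFactor (β γ : ℝ) (s t : Bool) : ℝ :=
  if s = t then (if s = true then β else γ) else 1

theorem edgeFactor_comm (β γ : ℝ) (s t : Bool) : edgeFactor β γ s t = edgeFactor β γ t s := by
  cases s <;> cases t <;> rfl

/-- The interaction along an unordered pair of vertices under the configuration `σ`. -/
def pairFactor {V : Type*} (β γ : ℝ) (σ : V → Bool) (e : Sym2 V) : ℝ :=
  Sym2.lift ⟨edgeFactor β γ, edgeFactor_comm β γ⟩ (e.map σ)

@[simp] theorem pairFactor_mk {V : Type*} (β γ : ℝ) (σ : V → Bool) (u v : V) :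
    pairFactor β γ σ s(u, v) = edgeFactor β γ (σ u) (σ v) := rfl

theorem IsAntiferro.pairFactor_nonneg {V : Type*} {β γ lam : ℝ}
    (h : IsAntiferro β γ lam) (σ : V → Bool) (e : Sym2 V) :
    0 ≤ pairFactor β γ σ e := by
  have h1 := h.beta_nonneg
  have h2 := h.gamma_pos
  induction e using Sym2.ind with
  | _ a b => rw [pairFactor_mk, edgeFactor]; split_ifs <;> linarith

variable {V : Type*} {β γ lam : ℝ}

/-- The weight `w` restricted to the configurations giving `v` the spin `s`. -/
def restrictSpin (w : (V → Bool) → ℝ) (v : V) (s : Bool) (σ : V → Bool) : ℝ :=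
  if σ v = s then w σ else 0

theorem restrictSpin_nonneg {w : (V → Bool) → ℝ} (hw : ∀ σ, 0 ≤ w σ) (v : V) (s : Bool)
    (σ : V → Bool) : 0 ≤ restrictSpin w v s σ := by
  unfold restrictSpin
  split_ifs
  exacts [hw σ, le_rfl]

variable [Fintype V]

/-- The weight of the two-spin system with edge set `E` and a vertex field `c`, where `c u t` is
the weight of giving `u` the spin `t`. -/
def fieldWeight (β γ : ℝ) (E : Finset (Sym2 V)) (c : V → Bool → ℝ) (σ : V → Bool) : ℝ :=
  (∏ e ∈ E, pairFactor β γ σ e) * ∏ u, c u (σ u)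

/-- A field is admissible for `E` if it is nonnegative and every vertex may take the spin `0`,
except that isolated vertices may be frozen at the spin `1`. -/
structure Admissible (E : Finset (Sym2 V)) (c : V → Bool → ℝ) : Prop where
  not_isDiag : ∀ e ∈ E, ¬ e.IsDiag
  nonneg : ∀ u t, 0 ≤ c u t
  pos : ∀ u, 0 < c u false ∨ (0 < c u true ∧ ∀ e ∈ E, u ∉ e)

theorem Admissible.fieldWeight_nonneg (h : IsAntiferro β γ lam) {E : Finset (Sym2 V)}
    {c : V → Bool → ℝ} (hc : Admissible E c) (σ : V → Bool) : 0 ≤ fieldWeight β γ E c σ :=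
  mul_nonneg (Finset.prod_nonneg fun e _ => h.pairFactor_nonneg σ e)
    (Finset.prod_nonneg fun u _ => hc.nonneg u _)

/-- Giving every vertex spin `0` where the field allows it is feasible, since two adjacent spins
`0` have weight `γ > 0`. -/
theorem Admissible.exists_fieldWeight_pos (h : IsAntiferro β γ lam) {E : Finset (Sym2 V)}
    {c : V → Bool → ℝ} (hc : Admissible E c) :
    ∃ η : V → Bool, (∀ u, 0 < c u false → η u = false) ∧ 0 < fieldWeight β γ E c η := by
  classical
  let η : V → Bool := fun u => if 0 < c u false then false else true
  refine ⟨η, fun u hu => by simp [η, hu], mul_pos (Finset.prod_pos fun e he => ?_)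
    (Finset.prod_pos fun u _ => ?_)⟩
  · have key : ∀ u ∈ e, η u = false := fun u hu => by
      rcases hc.pos u with hu' | hu'
      · simp [η, hu']
      · exact absurd hu (hu'.2 e he)
    induction e using Sym2.ind with
    | _ a b =>
      rw [pairFactor_mk, key a (by simp), key b (by simp)]
      simpa [edgeFactor] using h.gamma_pos
  · by_cases hu : 0 < c u false
    · simp [η, hu]
    · simpa [η, hu] using (hc.pos u).resolve_left hu |>.1

variable [DecidableEq V]

/-- The neighbours of `v` in the edge set `E`. -/
def nbrs (E : Finset (Sym2 V)) (v : V) : Finset V := Finset.univ.filter fun u => s(v, u) ∈ E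

/-- The edges of `E` that avoid `v`. -/
def eraseVertex (E : Finset (Sym2 V)) (v : V) : Finset (Sym2 V) := E.filter fun e => v ∉ e

/-- The field left behind when `v` is removed with spin `s`: the spin of `v` is frozen at `s`, and
each neighbour `u` absorbs the interaction with a copy of `v` of spin `η u`. Allowing `η` to vary
among the neighbours amounts to splitting `v` into one copy per incident edge. -/
def splitField (β γ : ℝ) (E : Finset (Sym2 V)) (c : V → Bool → ℝ) (v : V) (s : Bool)
    (η : V → Bool) : V → Bool → ℝ := fun u t =>
  if u = v then (if t = s then 1 else 0)
  else c u t * (if s(v, u) ∈ E then edgeFactor β γ (η u) t else 1)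

/-- Removing `v` with spin `s` leaves a system on the remaining edges. -/
theorem restrictSpin_fieldWeight (E : Finset (Sym2 V)) (hE : ∀ e ∈ E, ¬ e.IsDiag)
    (c : V → Bool → ℝ) (v : V) (s : Bool) (σ : V → Bool) :
    restrictSpin (fieldWeight β γ E c) v s σ =
      c v s * fieldWeight β γ (eraseVertex E v) (splitField β γ E c v s fun _ => s) σ := by
  have hfield : ∏ u, splitField β γ E c v s (fun _ => s) u (σ u) =
      (if σ v = s then 1 else 0) * ∏ u ∈ Finset.univ.erase v,
        (c u (σ u) * (if s(v, u) ∈ E then edgeFactor β γ s (σ u) else 1)) := by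
    rw [← Finset.mul_prod_erase _ _ (Finset.mem_univ v)]
    congr 1
    · simp [splitField]
    · exact Finset.prod_congr rfl fun u hu => by simp [splitField, Finset.ne_of_mem_erase hu]
  rw [restrictSpin, fieldWeight, fieldWeight, hfield]
  split_ifs with hs
  · have hv : ∏ e ∈ E with ¬ v ∉ e, pairFactor β γ σ e =
        ∏ u ∈ Finset.univ.erase v, (if s(v, u) ∈ E then edgeFactor β γ s (σ u) else 1) := by
      rw [← Finset.prod_filter]
      symm
      refine Finset.prod_bij (fun u _ => s(v, u)) (fun u hu => ?_) (fun u _ u' _ he => ?_)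
        (fun e he => ?_) (fun u _ => by simp [hs])
      · simp only [Finset.mem_filter] at hu
        simp [hu.2]
      · simp only [Sym2.eq_iff] at he
        rcases he with he | he
        exacts [he.2, he.2.trans he.1]
      · simp only [Finset.mem_filter, not_not] at he
        obtain ⟨u, rfl⟩ := he.2
        refine ⟨u, ?_, rfl⟩
        have := hE _ he.1
        simp only [Sym2.mk_isDiag_iff] at this
        simp [he.1, Ne.symm this]
    rw [← Finset.prod_filter_mul_prod_filter_not E (fun e => v ∉ e), hv,
      ← Finset.mul_prod_erase _ _ (Finset.mem_univ v), Finset.prod_mul_distrib, eraseVertex, hs]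
    ring
  · simp

/-- Changing the field at the single vertex `u` by a spin-dependent factor. -/
theorem fieldWeight_mul_at (E : Finset (Sym2 V)) (c c' : V → Bool → ℝ) (u : V) (a : Bool → ℝ)
    (hu : ∀ t, c' u t = c u t * a t) (hne : ∀ x, x ≠ u → c' x = c x) (σ : V → Bool) :
    fieldWeight β γ E c' σ = fieldWeight β γ E c σ * a (σ u) := by
  rw [fieldWeight, fieldWeight, ← Finset.mul_prod_erase _ _ (Finset.mem_univ u),
    ← Finset.mul_prod_erase _ (fun x => c x (σ x)) (Finset.mem_univ u), hu,
    Finset.prod_congr rfl fun x hx => congrFun (hne x (Finset.ne_of_mem_erase hx)) (σ x)]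
  ring

theorem Admissible.sum_restrictSpin_false_pos (h : IsAntiferro β γ lam) {E : Finset (Sym2 V)}
    {c : V → Bool → ℝ} (hc : Admissible E c) {v : V} (hv : 0 < c v false) :
    0 < ∑ σ, restrictSpin (fieldWeight β γ E c) v false σ := by
  obtain ⟨η, h0, h1⟩ := hc.exists_fieldWeight_pos h
  exact Finset.sum_pos' (fun σ _ => restrictSpin_nonneg (hc.fieldWeight_nonneg h) v _ σ)
    ⟨η, Finset.mem_univ _, by rwa [restrictSpin, if_pos (h0 v hv)]⟩

theorem Admissible.sum_pos (h : IsAntiferro β γ lam) {E : Finset (Sym2 V)}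
    {c : V → Bool → ℝ} (hc : Admissible E c) : 0 < ∑ σ, fieldWeight β γ E c σ := by
  obtain ⟨η, -, h1⟩ := hc.exists_fieldWeight_pos h
  exact Finset.sum_pos' (fun σ _ => hc.fieldWeight_nonneg h σ) ⟨η, Finset.mem_univ _, h1⟩

theorem sum_eq_sum_restrictSpin (w : (V → Bool) → ℝ) (v : V) :
    ∑ σ, w σ = ∑ σ, restrictSpin w v true σ + ∑ σ, restrictSpin w v false σ := by
  rw [← Finset.sum_add_distrib]
  refine Finset.sum_congr rfl fun σ _ => ?_
  cases hs : σ v <;> simp [restrictSpin, hs]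

/-! ### The effect of a field at one vertex -/

/-- The ratio of the weights of spin `1` and spin `0` at `v`. -/
noncomputable def spinRatio (w : (V → Bool) → ℝ) (v : V) : ℝ :=
  (∑ σ, restrictSpin w v true σ) / ∑ σ, restrictSpin w v false σ

theorem normalized_smul {a : ℝ} (ha : a ≠ 0) (w : (V → Bool) → ℝ) :
    normalized (fun σ => a * w σ) = normalized w := by
  ext σ
  rw [normalized, normalized, ← Finset.mul_sum, mul_div_mul_left _ _ ha]

theorem normalized_nonneg {w : (V → Bool) → ℝ} (hw : ∀ σ, 0 ≤ w σ) (σ : V → Bool) :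
    0 ≤ normalized w σ := div_nonneg (hw σ) (Finset.sum_nonneg fun y _ => hw y)

theorem sum_normalized_le_one (w : (V → Bool) → ℝ) : ∑ σ, normalized w σ ≤ 1 := by
  simp only [normalized, ← Finset.sum_div]
  exact div_self_le_one _

theorem sum_mul_spin (w : (V → Bool) → ℝ) (u : V) (a : Bool → ℝ) :
    ∑ σ, w σ * a (σ u) = a true * ∑ σ, restrictSpin w u true σ +
      a false * ∑ σ, restrictSpin w u false σ := by
  rw [sum_eq_sum_restrictSpin _ u, Finset.mul_sum, Finset.mul_sum]
  congr 1 <;> refine Finset.sum_congr rfl fun σ _ => ?_ <;> unfold restrictSpin <;>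
    split_ifs with hs <;> simp [hs, mul_comm]

/-- Reweighting the spin at `u` gives a mixture of the two conditional distributions. -/
theorem normalized_mul_spin {w : (V → Bool) → ℝ} (hw : ∀ σ, 0 ≤ w σ) (u : V)
    (hZ : 0 < ∑ σ, restrictSpin w u false σ) {a : Bool → ℝ} (ha : 0 ≤ a true)
    (ha' : 0 < a false) :
    normalized (fun σ => w σ * a (σ u)) =
      (a true * spinRatio w u / (a true * spinRatio w u + a false)) •
          normalized (restrictSpin w u true) +
        (a false / (a true * spinRatio w u + a false)) •
          normalized (restrictSpin w u false) := by
  have hr : ∀ s σ, 0 ≤ restrictSpin w u s σ := fun s σ =>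
    restrictSpin_nonneg hw u s σ
  have hZ1 : 0 ≤ ∑ σ, restrictSpin w u true σ := Finset.sum_nonneg fun σ _ => hr _ σ
  ext σ
  simp only [normalized, sum_mul_spin, Pi.add_apply, Pi.smul_apply, smul_eq_mul, spinRatio]
  set Z1 := ∑ σ, restrictSpin w u true σ with hZ1def
  set Z0 := ∑ σ, restrictSpin w u false σ
  have hD : 0 < a true * Z1 + a false * Z0 := by positivity
  have e : a true * (Z1 / Z0) + a false = (a true * Z1 + a false * Z0) / Z0 := by
    field_simp
  rw [e]
  rcases hZ1.eq_or_lt with h0 | h0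
  -- spin `1` at `u` may be infeasible, and then its normalisation is the junk value `0`
  · have hz : restrictSpin w u true σ = 0 :=
      (Finset.sum_eq_zero_iff_of_nonneg fun σ _ => hr true σ).1 (hZ1def.symm.trans h0.symm) σ
        (Finset.mem_univ σ)
    rw [hz]
    cases hs : σ u
    · simp only [restrictSpin, hs, if_true, zero_div, mul_zero, zero_add]
      field_simp
    · have : w σ = 0 := by simpa [restrictSpin, hs] using hz
      simp [restrictSpin, hs, this]
  · cases hs : σ u <;> simp only [restrictSpin, hs] <;> simp <;> field_simp

/-- Flipping the spin at the other end of one edge at `u` moves the distribution by the influence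
times the cost of flipping the spin at `u`. -/
theorem TransportBound.flip_edge (h : IsAntiferro β γ lam) {w : (V → Bool) → ℝ}
    (hw : ∀ σ, 0 ≤ w σ) (u : V) (hZ : 0 < ∑ σ, restrictSpin w u false σ) {C : ℝ}
    (hC : 0 < spinRatio w u →
      TransportBound (normalized (restrictSpin w u true)) (normalized (restrictSpin w u false)) C) :
    TransportBound (normalized fun σ => w σ * edgeFactor β γ true (σ u))
      (normalized fun σ => w σ * edgeFactor β γ false (σ u))
      (influence β γ (spinRatio w u) * C) := by
  have h1 := h.beta_nonneg
  have h2 := h.gamma_pos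
  have hr : ∀ s σ, 0 ≤ restrictSpin w u s σ := fun s σ =>
    restrictSpin_nonneg hw u s σ
  have hy : 0 ≤ spinRatio w u := div_nonneg (Finset.sum_nonneg fun σ _ => hr _ σ) hZ.le
  rw [normalized_mul_spin hw u hZ (a := edgeFactor β γ true) (by simpa [edgeFactor])
      (by simp [edgeFactor]),
    normalized_mul_spin hw u hZ (a := edgeFactor β γ false) (by simp [edgeFactor])
      (by simpa [edgeFactor])]
  simp only [edgeFactor, if_true, if_false, Bool.false_eq_true, Bool.true_eq_false,
    one_mul]
  set y := spinRatio w u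
  set n1 := normalized (restrictSpin w u true)
  set n0 := normalized (restrictSpin w u false)
  have hn1 : ∀ σ, 0 ≤ n1 σ := normalized_nonneg (hr true)
  have hn0 : ∀ σ, 0 ≤ n0 σ := normalized_nonneg (hr false)
  have hI := h.influence_nonneg hy
  have hp : 0 < y + γ := by positivity
  have hq : 0 < β * y + 1 := by positivity
  have e1 : y / (y + γ) = β * y / (β * y + 1) + influence β γ y := by
    unfold influence; field_simp; ring
  have e0 : 1 / (β * y + 1) = γ / (y + γ) + influence β γ y := by
    unfold influence; field_simp; ring
  have hA : TransportBound ((β * y / (β * y + 1)) • n1) ((β * y / (β * y + 1)) • n1) 0 := by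
    simpa using (TransportBound.refl hn1).smul (a := β * y / (β * y + 1)) (by positivity)
  have hB : TransportBound ((γ / (y + γ)) • n0) ((γ / (y + γ)) • n0) 0 := by
    simpa using (TransportBound.refl hn0).smul (a := γ / (y + γ)) (by positivity)
  have hD : TransportBound (influence β γ y • n0) (influence β γ y • n1)
      (influence β γ y * C) := by
    rcases hy.eq_or_lt with h0 | h0
    · have : influence β γ y = 0 := by rw [← h0]; simp [influence]
      rw [this]
      simpa using (TransportBound.refl hn0).smul le_rfl
    · exact (hC h0).symm.smul hI
  have := (hA.add hB).add hD
  rw [e1, e0]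
  convert this using 1
  · module
  · module
  · ring

end Systems

/-! ### Removing a vertex -/

section Recursion

theorem Admissible.splitField {V : Type*} [DecidableEq V] {β γ lam : ℝ}
    (h : IsAntiferro β γ lam) {E : Finset (Sym2 V)}
    {c : V → Bool → ℝ} (hc : Admissible E c) (v : V) (s : Bool) (η : V → Bool) :
    Admissible (eraseVertex E v) (splitField β γ E c v s η) := by
  have h1 := h.beta_nonneg
  have h2 := h.gamma_pos
  refine ⟨fun e he => hc.not_isDiag e (Finset.mem_of_mem_filter e he), fun u t => ?_, fun u => ?_⟩
  · have h3 := hc.nonneg u t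
    unfold TwoSpin.splitField edgeFactor
    split_ifs <;> positivity
  · by_cases huv : u = v
    · subst huv
      cases s
      · left; simp [TwoSpin.splitField]
      · right
        refine ⟨by simp [TwoSpin.splitField], fun e he => (Finset.mem_filter.1 he).2⟩
    · rcases hc.pos u with hu | ⟨hu, hE⟩
      · left
        simp only [TwoSpin.splitField, huv, edgeFactor, if_false]
        split_ifs <;> simp_all
      · right
        have hv : s(v, u) ∉ E := fun hx => hE _ hx (by simp)
        exact ⟨by simpa [TwoSpin.splitField, huv, hv] using hu,
          fun e he => hE e (Finset.mem_of_mem_filter e he)⟩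

/-- The field left behind when `v` is removed, its copies have the spins `η`, and the copy attached
to `u` is dropped. -/
noncomputable def dropField {V : Type*} [DecidableEq V] (β γ : ℝ) (E : Finset (Sym2 V))
    (c : V → Bool → ℝ) (v u : V) (η : V → Bool) : V → Bool → ℝ :=
  Function.update (splitField β γ E c v false η) u (c u)

theorem Admissible.dropField {V : Type*} [DecidableEq V] {β γ lam : ℝ}
    (h : IsAntiferro β γ lam) {E : Finset (Sym2 V)}
    {c : V → Bool → ℝ} (hc : Admissible E c) (v u : V) (η : V → Bool) :
    Admissible (eraseVertex E v) (dropField β γ E c v u η) := by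
  have hs := hc.splitField h v false η
  refine ⟨hs.not_isDiag, fun x t => ?_, fun x => ?_⟩
  · by_cases hx : x = u
    · subst hx; simpa [TwoSpin.dropField] using hc.nonneg x t
    · simpa [TwoSpin.dropField, hx] using hs.nonneg x t
  · by_cases hx : x = u
    · subst hx
      simp only [TwoSpin.dropField, Function.update_self]
      exact (hc.pos x).imp_right fun hp =>
        ⟨hp.1, fun e he => hp.2 e (Finset.mem_of_mem_filter e he)⟩
    · simpa [TwoSpin.dropField, hx] using hs.pos x

variable {V : Type*} [Fintype V] [DecidableEq V] {β γ lam : ℝ}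

/-- `u` carries the field left by the removal of some neighbours, `k₁` of them with spin `1` and
`k₀` with spin `0`, and has at most `n` neighbours when these are counted; exactly `n` of them
when `γ > 1`. -/
def Live (β γ lam : ℝ) (E : Finset (Sym2 V)) (c : V → Bool → ℝ) (u : V) (n : ℕ) : Prop :=
  ∃ k₁ k₀ : ℕ, c u true = lam * β ^ k₁ ∧ c u false = γ ^ k₀ ∧
    (nbrs E u).card + k₁ + k₀ ≤ n ∧ (1 < γ → (nbrs E u).card + k₁ + k₀ = n)

theorem mem_nbrs {E : Finset (Sym2 V)} {u v : V} : u ∈ nbrs E v ↔ s(v, u) ∈ E := by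
  simp [nbrs]

theorem mem_nbrs_comm {E : Finset (Sym2 V)} {u v : V} : u ∈ nbrs E v ↔ v ∈ nbrs E u := by
  rw [mem_nbrs, mem_nbrs, Sym2.eq_swap]

theorem nbrs_eraseVertex {E : Finset (Sym2 V)} {u v : V} (huv : u ≠ v) :
    nbrs (eraseVertex E v) u = (nbrs E u).erase v := by
  ext x
  simp [mem_nbrs, eraseVertex, huv.symm, and_comm, eq_comm]

theorem nbrs_eraseVertex_self (E : Finset (Sym2 V)) (v : V) :
    nbrs (eraseVertex E v) v = ∅ := by
  ext x
  simp [mem_nbrs, eraseVertex]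

theorem nbrs_eraseVertex_subset (E : Finset (Sym2 V)) (u v : V) :
    nbrs (eraseVertex E v) u ⊆ nbrs E u := by
  intro x
  simp only [mem_nbrs, eraseVertex, Finset.mem_filter]
  exact And.left

theorem Live.splitField {E : Finset (Sym2 V)} {c : V → Bool → ℝ} {u v : V} {n : ℕ}
    (hu : Live β γ lam E c u n) (huv : u ≠ v) (s : Bool) (η : V → Bool) :
    Live β γ lam (eraseVertex E v) (splitField β γ E c v s η) u n := by
  obtain ⟨k₁, k₀, h1, h0, hle, heq⟩ := hu
  by_cases hv : s(v, u) ∈ E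
  · have hcard : ((nbrs E u).erase v).card + 1 = (nbrs E u).card :=
      Finset.card_erase_add_one (mem_nbrs_comm.1 (mem_nbrs.2 hv))
    cases hη : η u
    · refine ⟨k₁, k₀ + 1, ?_, ?_, ?_, fun hγ => ?_⟩
      · simp [TwoSpin.splitField, huv, hv, hη, edgeFactor, h1]
      · simp [TwoSpin.splitField, huv, hv, hη, edgeFactor, h0, pow_succ]
      · rw [nbrs_eraseVertex huv]; omega
      · have := heq hγ
        rw [nbrs_eraseVertex huv]; omega
    · refine ⟨k₁ + 1, k₀, ?_, ?_, ?_, fun hγ => ?_⟩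
      · simp [TwoSpin.splitField, huv, hv, hη, edgeFactor, h1, pow_succ, mul_assoc]
      · simp [TwoSpin.splitField, huv, hv, hη, edgeFactor, h0]
      · rw [nbrs_eraseVertex huv]; omega
      · have := heq hγ
        rw [nbrs_eraseVertex huv]; omega
  · refine ⟨k₁, k₀, ?_, ?_, ?_, fun hγ => ?_⟩
    · simp [TwoSpin.splitField, huv, hv, h1]
    · simp [TwoSpin.splitField, huv, hv, h0]
    all_goals
      rw [nbrs_eraseVertex huv, Finset.erase_eq_of_notMem fun hx => hv
        (mem_nbrs.1 (mem_nbrs_comm.1 hx))]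
    exacts [hle, heq hγ]

/-- If the edge to `v` is dropped altogether, then `u` loses one unit of degree. -/
theorem Live.eraseVertex {E : Finset (Sym2 V)} {c c' : V → Bool → ℝ} {u v : V} {n : ℕ}
    (hu : Live β γ lam E c u (n + 1)) (huv : u ≠ v) (hv : u ∈ nbrs E v) (hc : c' u = c u) :
    Live β γ lam (TwoSpin.eraseVertex E v) c' u n := by
  obtain ⟨k₁, k₀, h1, h0, hle, heq⟩ := hu
  have hcard : ((nbrs E u).erase v).card + 1 = (nbrs E u).card :=
    Finset.card_erase_add_one (mem_nbrs_comm.1 hv)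
  refine ⟨k₁, k₀, hc ▸ h1, hc ▸ h0, ?_, fun hγ => ?_⟩
  · rw [nbrs_eraseVertex huv]; omega
  · have := heq hγ
    rw [nbrs_eraseVertex huv]; omega

theorem Live.congr_field {E : Finset (Sym2 V)} {c c' : V → Bool → ℝ} {u : V} {n : ℕ}
    (hu : Live β γ lam E c u n) (hc : c' u = c u) : Live β γ lam E c' u n := by
  obtain ⟨k₁, k₀, h1, h0, hle, heq⟩ := hu
  exact ⟨k₁, k₀, hc ▸ h1, hc ▸ h0, hle, heq⟩

theorem Live.field_false_pos (h : IsAntiferro β γ lam) {E : Finset (Sym2 V)}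
    {c : V → Bool → ℝ} {u : V} {n : ℕ} (hu : Live β γ lam E c u n) : 0 < c u false := by
  obtain ⟨k₁, k₀, -, h0, -⟩ := hu
  have := h.gamma_pos
  rw [h0]
  positivity

/-- The hypothesis of the recursion at `v`: flipping the spin of a neighbour `u`, after `v` has been
split and the copy at `u` dropped, costs at most `B y` where `y` is the marginal ratio of `u`. -/
def ChildBound (β γ : ℝ) (E : Finset (Sym2 V)) (c : V → Bool → ℝ) (v : V) (B : ℝ → ℝ) : Prop :=
  ∀ u ∈ nbrs E v, ∀ η : V → Bool,
    let w := fieldWeight β γ (eraseVertex E v) (dropField β γ E c v u η)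
    0 < spinRatio w u → TransportBound (normalized (restrictSpin w u true))
      (normalized (restrictSpin w u false)) (B (spinRatio w u))

/-- Switching the copies of `v` attached to the vertices of `S` one at a time from spin `0` to
spin `1`. The same marginal ratios `y` control the partition functions and the transport cost. -/
theorem exists_ratios_of_subset (h : IsAntiferro β γ lam) {E : Finset (Sym2 V)}
    {c : V → Bool → ℝ} (hc : Admissible E c) {v : V} (hpos : ∀ u ∈ nbrs E v, 0 < c u false)
    {B : ℝ → ℝ} (hB : ChildBound β γ E c v B) (S : Finset V) (hS : S ⊆ nbrs E v) :
    let w := fun T : Finset V =>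
      fieldWeight β γ (eraseVertex E v) (splitField β γ E c v false fun x => decide (x ∈ T))
    ∃ y : V → ℝ, (∀ u, 0 ≤ y u) ∧
      ∑ σ, w S σ = (∑ σ, w ∅ σ) * ∏ u ∈ S, (β * y u + 1) / (y u + γ) ∧
      TransportBound (normalized (w S)) (normalized (w ∅))
        (∑ u ∈ S, influence β γ (y u) * B (y u)) := by
  intro w
  have h1 := h.beta_nonneg
  have h2 := h.gamma_pos
  have hw : ∀ T σ, 0 ≤ w T σ := fun T => (hc.splitField h v false _).fieldWeight_nonneg h
  induction S using Finset.induction_on with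
  | empty =>
    exact ⟨fun _ => 0, fun _ => le_rfl, by simp,
      by simpa using TransportBound.refl (normalized_nonneg (hw ∅))⟩
  | insert u S huS ih =>
    obtain ⟨y, hy, hyZ, hyT⟩ := ih ((Finset.subset_insert u S).trans hS)
    have huv : u ∈ nbrs E v := hS (Finset.mem_insert_self u S)
    have huE : s(v, u) ∈ E := mem_nbrs.1 huv
    have hne : u ≠ v := by
      rintro rfl
      exact hc.not_isDiag _ huE (by simp)
    set c' := dropField β γ E c v u fun x => decide (x ∈ S) with hc'
    set w' := fieldWeight β γ (eraseVertex E v) c'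
    have hadm : Admissible (eraseVertex E v) c' := hc.dropField h v u _
    have hw' : ∀ σ, 0 ≤ w' σ := hadm.fieldWeight_nonneg h
    have e0 : w S = fun σ => w' σ * edgeFactor β γ false (σ u) := by
      funext σ
      refine fieldWeight_mul_at _ c' _ u _ (fun t => ?_) (fun x hx => ?_) σ
      · simp [hc', dropField, splitField, hne, huE, huS]
      · simp [hc', dropField, hx]
    have e1 : w (insert u S) = fun σ => w' σ * edgeFactor β γ true (σ u) := by
      funext σ
      refine fieldWeight_mul_at _ c' _ u _ (fun t => ?_) (fun x hx => ?_) σ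
      · simp [hc', dropField, splitField, hne, huE]
      · funext t
        simp [hc', dropField, splitField, hx]
    have hZ : 0 < ∑ σ, restrictSpin w' u false σ :=
      hadm.sum_restrictSpin_false_pos h (by simpa [hc', dropField] using hpos u huv)
    have hy0 : 0 ≤ spinRatio w' u :=
      div_nonneg (Finset.sum_nonneg fun σ _ => restrictSpin_nonneg hw' u _ σ) hZ.le
    have hyu : ∀ x ∈ S, Function.update y u (spinRatio w' u) x = y x := fun x hx =>
      Function.update_of_ne (ne_of_mem_of_not_mem hx huS) _ _
    refine ⟨Function.update y u (spinRatio w' u), fun x => ?_, ?_, ?_⟩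
    · by_cases hx : x = u
      · subst hx; simpa using hy0
      · simpa [hx] using hy x
    · rw [Finset.prod_insert huS, Finset.prod_congr rfl fun x hx => by rw [hyu x hx],
        Function.update_self, mul_left_comm, ← hyZ, e0, e1, sum_mul_spin, sum_mul_spin]
      simp only [edgeFactor, if_true, if_false, Bool.false_eq_true, Bool.true_eq_false,
        one_mul, spinRatio]
      set Z1 := ∑ σ, restrictSpin w' u true σ
      set Z0 := ∑ σ, restrictSpin w' u false σ
      have hZ1 : 0 ≤ Z1 := Finset.sum_nonneg fun σ _ => restrictSpin_nonneg hw' u _ σ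
      have : 0 < Z1 + γ * Z0 := by positivity
      have e : Z1 / Z0 + γ = (Z1 + γ * Z0) / Z0 := by field_simp
      rw [e]
      field_simp
    · rw [Finset.sum_insert huS, Finset.sum_congr rfl fun x hx => by rw [hyu x hx],
        Function.update_self]
      have := TransportBound.flip_edge h hw' u hZ (hB u huv _)
      rw [← e0, ← e1] at this
      exact this.trans hyT

/-- The recursion at `v`: its marginal ratio satisfies the tree recursion in the ratios `y` of its
neighbours, and the cost of flipping it is one plus the sum of the costs at the neighbours, each
discounted by the influence. -/
theorem exists_ratios (h : IsAntiferro β γ lam) {E : Finset (Sym2 V)}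
    {c : V → Bool → ℝ} (hc : Admissible E c) {v : V} (hpos : ∀ u ∈ nbrs E v, 0 < c u false)
    (hv0 : 0 < c v false) (hv1 : 0 < c v true) {B : ℝ → ℝ} (hB : ChildBound β γ E c v B) :
    let w := fieldWeight β γ E c
    ∃ y : V → ℝ, (∀ u, 0 ≤ y u) ∧
      spinRatio w v = c v true / c v false * ∏ u ∈ nbrs E v, (β * y u + 1) / (y u + γ) ∧
      TransportBound (normalized (restrictSpin w v true)) (normalized (restrictSpin w v false))
        (1 + ∑ u ∈ nbrs E v, influence β γ (y u) * B (y u)) := by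
  intro w
  obtain ⟨y, hy, hyZ, hyT⟩ := exists_ratios_of_subset h hc hpos hB (nbrs E v) subset_rfl
  have e1 : (splitField β γ E c v false fun x => decide (x ∈ nbrs E v)) =
      splitField β γ E c v false fun _ => true := by
    funext x t
    by_cases hx : s(v, x) ∈ E <;> simp [splitField, mem_nbrs, hx]
  have e0 : (splitField β γ E c v false fun x => decide (x ∈ (∅ : Finset V))) =
      splitField β γ E c v false fun _ => false := by
    simp
  simp only [e1, e0] at hyZ hyT
  set W := fun s t : Bool =>
    fieldWeight β γ (eraseVertex E v) (splitField β γ E c v s fun _ => t) with hW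
  have hWnn : ∀ s t σ, 0 ≤ W s t σ := fun s t => (hc.splitField h v s _).fieldWeight_nonneg h
  -- the two frozen spins of `v` differ by the flip of the isolated coordinate `v`
  let f : (V → Bool) → (V → Bool) := fun x => Function.update x v (!x v)
  have hf : Function.Involutive f := fun x => by simp [f]
  have hflip : W false true = W true true ∘ f := by
    funext σ
    simp only [hW, Function.comp, fieldWeight]
    congr 1
    · refine Finset.prod_congr rfl fun e he => ?_
      have hve : v ∉ e := (Finset.mem_filter.1 he).2
      induction e using Sym2.ind with
      | _ a b =>
        simp only [Sym2.mem_iff, not_or] at hve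
        simp [f, Ne.symm hve.1, Ne.symm hve.2]
    · refine Finset.prod_congr rfl fun u _ => ?_
      by_cases hu : u = v
      · subst hu; simp [f, splitField]
      · simp [f, splitField, hu]
  have hsum : ∑ σ, W false true σ = ∑ σ, W true true σ := by
    rw [hflip]
    exact Equiv.sum_comp (hf.toPerm f) (W true true)
  have hd : ∀ x, hammingDist x (f x) ≤ 1 := fun x => by
    refine (Finset.card_le_card (t := {v}) fun u hu => ?_).trans (Finset.card_singleton v).le
    by_contra hne
    simp only [Finset.mem_singleton] at hne
    simp [f, hne] at hu
  have hT : TransportBound (normalized (W true true)) (normalized (W false true)) 1 := by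
    have e : normalized (W false true) = normalized (W true true) ∘ f := by
      funext σ
      simp only [normalized, Function.comp, hsum]
      rw [hflip]; rfl
    rw [e]
    exact TransportBound.comp_involutive (normalized_nonneg (hWnn _ _))
      (sum_normalized_le_one _) hf hd
  have hr : ∀ s, restrictSpin w v s = fun σ => c v s * W s s σ := fun s =>
    funext fun σ => restrictSpin_fieldWeight E hc.not_isDiag c v s σ
  refine ⟨y, hy, ?_, ?_⟩
  · have hZ : 0 < ∑ σ, W false false σ := (hc.splitField h v false _).sum_pos h
    rw [spinRatio, hr, hr, ← Finset.mul_sum, ← Finset.mul_sum, ← hsum, hyZ]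
    field_simp
    rw [mul_comm]
  · rw [hr, hr, normalized_smul hv1.ne', normalized_smul hv0.ne']
    exact hT.trans hyT

end Recursion

/-! ### Contraction of the recursion -/

section Contraction

variable {V : Type*} [Fintype V] [DecidableEq V] {β γ lam : ℝ}

/-- A system in which the vertex `v` has degree bound `n`, and every other non-isolated vertex has
degree bound `d + 1`. -/
structure Rooted (β γ lam : ℝ) (d : ℕ) (E : Finset (Sym2 V)) (c : V → Bool → ℝ) (v : V)
    (n : ℕ) : Prop where
  admissible : Admissible E c
  root : Live β γ lam E c v n
  others : ∀ u, u ≠ v → (nbrs E u).Nonempty → Live β γ lam E c u (d + 1)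

theorem Rooted.ne_of_mem_nbrs {d n : ℕ} {E : Finset (Sym2 V)} {c : V → Bool → ℝ} {v u : V}
    (hR : Rooted β γ lam d E c v n) (hu : u ∈ nbrs E v) : u ≠ v := by
  rintro rfl
  exact hR.admissible.not_isDiag _ (mem_nbrs.1 hu) (by simp)

theorem Rooted.live_of_mem_nbrs {d n : ℕ} {E : Finset (Sym2 V)} {c : V → Bool → ℝ} {v u : V}
    (hR : Rooted β γ lam d E c v n) (hu : u ∈ nbrs E v) : Live β γ lam E c u (d + 1) :=
  hR.others u (hR.ne_of_mem_nbrs hu) ⟨v, mem_nbrs_comm.1 hu⟩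

theorem Rooted.dropField (h : IsAntiferro β γ lam) {d n : ℕ} {E : Finset (Sym2 V)}
    {c : V → Bool → ℝ} {v u : V} (hR : Rooted β γ lam d E c v n) (hu : u ∈ nbrs E v)
    (η : V → Bool) :
    Rooted β γ lam d (eraseVertex E v) (dropField β γ E c v u η) u d := by
  refine ⟨hR.admissible.dropField h v u η,
    (hR.live_of_mem_nbrs hu).eraseVertex (hR.ne_of_mem_nbrs hu) hu
      (by simp [TwoSpin.dropField]), fun x hx hne => ?_⟩
  have hxv : x ≠ v := by
    rintro rfl
    rw [nbrs_eraseVertex_self] at hne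
    simp at hne
  exact ((hR.others x hxv (hne.mono (nbrs_eraseVertex_subset E x v))).splitField hxv false
    η).congr_field (by simp [TwoSpin.dropField, hx])

theorem card_eraseVertex_lt {E : Finset (Sym2 V)} {v u : V} (hu : u ∈ nbrs E v) :
    (eraseVertex E v).card < E.card :=
  Finset.card_lt_card <| Finset.filter_ssubset.2 ⟨s(v, u), mem_nbrs.1 hu, by simp⟩

/-- The cost of flipping the root is bounded by the potential of its marginal ratio. -/
theorem Rooted.transportBound_potential (h : IsAntiferro β γ lam) {d : ℕ} {x : ℝ} (hx : 0 < x)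
    (hfix : treeRec β γ lam d x = x) (hd : d * influence β γ x < 1) (N : ℕ) :
    ∀ (E : Finset (Sym2 V)) (c : V → Bool → ℝ) (v : V), E.card = N →
      Rooted β γ lam d E c v d → 0 < spinRatio (fieldWeight β γ E c) v →
      TransportBound (normalized (restrictSpin (fieldWeight β γ E c) v true))
        (normalized (restrictSpin (fieldWeight β γ E c) v false))
        ((1 - d * influence β γ x)⁻¹ * potential β γ x (spinRatio (fieldWeight β γ E c) v)) := by
  induction N using Nat.strong_induction_on with
  | _ N ih =>
  intro E c v hN hR hpos
  have hB : ChildBound β γ E c v fun y => (1 - d * influence β γ x)⁻¹ * potential β γ x y :=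
    fun u hu η => ih _ (hN ▸ card_eraseVertex_lt hu) _ _ u rfl (hR.dropField h hu η)
  have hv0 := hR.root.field_false_pos h
  have hv1 : 0 < c v true := by
    refine lt_of_le_of_ne (hR.admissible.nonneg v true) fun h0 => hpos.ne' ?_
    have : ∀ σ, restrictSpin (fieldWeight β γ E c) v true σ = 0 := fun σ => by
      rw [restrictSpin_fieldWeight E hR.admissible.not_isDiag, ← h0, zero_mul]
    simp [spinRatio, this]
  obtain ⟨y, hy, hz, hT⟩ := exists_ratios h hR.admissible
    (fun u hu => (hR.live_of_mem_nbrs hu).field_false_pos h) hv0 hv1 hB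
  obtain ⟨k₁, k₀, h1, h0, hle, heq⟩ := hR.root
  rw [h1, h0] at hz
  refine hT.mono (le_trans ?_ (h.sum_envelope_le hx hfix hd hy hle heq hpos hz))
  have hK : 0 < (1 - d * influence β γ x)⁻¹ := inv_pos.2 (by linarith)
  rw [Finset.mul_sum]
  refine add_le_add le_rfl (Finset.sum_le_sum fun u _ => ?_)
  rw [mul_left_comm]
  exact mul_le_mul_of_nonneg_left (h.influence_mul_potential_le_of_nonneg hx (hy u)) hK.le

/-- A root with one more child: each child contributes at most the maximum of the envelope. -/
theorem Rooted.transportBound (h : IsAntiferro β γ lam) {d : ℕ} {x : ℝ} (hx : 0 < x)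
    (hfix : treeRec β γ lam d x = x) (hd : d * influence β γ x < 1) {E : Finset (Sym2 V)}
    {c : V → Bool → ℝ} {v : V} (hR : Rooted β γ lam d E c v (d + 1)) (hv1 : 0 < c v true) :
    TransportBound (normalized (restrictSpin (fieldWeight β γ E c) v true))
      (normalized (restrictSpin (fieldWeight β γ E c) v false))
      (1 + (d + 1) * (influence β γ x / (1 - d * influence β γ x))) := by
  have hB : ChildBound β γ E c v fun y => (1 - d * influence β γ x)⁻¹ * potential β γ x y :=
    fun u hu η => Rooted.transportBound_potential h hx hfix hd _ _ _ u rfl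
      (hR.dropField h hu η)
  obtain ⟨y, hy, -, hT⟩ := exists_ratios h hR.admissible
    (fun u hu => (hR.live_of_mem_nbrs hu).field_false_pos h) (hR.root.field_false_pos h) hv1 hB
  obtain ⟨k₁, k₀, -, -, hle, -⟩ := hR.root
  refine hT.mono ?_
  have hK : 0 < (1 - d * influence β γ x)⁻¹ := inv_pos.2 (by linarith)
  have hI := h.influence_nonneg hx.le
  have hcard : ((nbrs E v).card : ℝ) ≤ d + 1 := by exact_mod_cast (by omega : _ ≤ d + 1)
  gcongr
  calc _ ≤ ∑ u ∈ nbrs E v, influence β γ x / (1 - d * influence β γ x) := by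
        refine Finset.sum_le_sum fun u _ => ?_
        rw [mul_left_comm, div_eq_inv_mul]
        exact mul_le_mul_of_nonneg_left ((h.influence_mul_potential_le_of_nonneg hx (hy u)).trans
          (envelope_le _ _ _ _)) hK.le
    _ = (nbrs E v).card * (influence β γ x / (1 - d * influence β γ x)) := by simp
    _ ≤ _ := by
        have := div_nonneg hI (sub_nonneg.2 hd.le)
        gcongr

end Contraction

/-! ### Pinning a set of vertices -/

section Pinning

variable {V : Type*} [Fintype V] [DecidableEq V] {β γ lam : ℝ}

/-- Conditioning a system on a feasible pinning of `S` gives, up to a constant, a system in which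
the vertices of `S` are isolated and the other vertices keep their degree bounds. -/
theorem exists_pinned_system (h : IsAntiferro β γ lam) {E : Finset (Sym2 V)}
    {c : V → Bool → ℝ} (hc : Admissible E c) (S : Finset V) {X : V → Bool}
    (hX : 0 < fieldWeight β γ E c X) :
    ∃ (E' : Finset (Sym2 V)) (c' : V → Bool → ℝ) (a : ℝ), 0 < a ∧ Admissible E' c' ∧
      (∀ u ∉ S, ∀ n, Live β γ lam E c u n → Live β γ lam E' c' u n) ∧
      (∀ u ∈ S, nbrs E' u = ∅) ∧
      ∀ x, (if ∀ u ∈ S, x u = X u then fieldWeight β γ E c x else 0) =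
        a * fieldWeight β γ E' c' x := by
  induction S using Finset.induction_on with
  | empty => exact ⟨E, c, 1, one_pos, hc, fun _ _ _ hL => hL, by simp, by simp⟩
  | insert w S hw ih =>
    obtain ⟨E', c', a, ha, hc', hL, hiso, heq⟩ := ih
    have hpos : 0 < c' w (X w) := by
      refine lt_of_le_of_ne (hc'.nonneg _ _) fun h0 => hX.ne' ?_
      have := heq X
      rw [if_pos fun _ _ => rfl] at this
      rw [this, fieldWeight, Finset.prod_eq_zero (Finset.mem_univ w) h0.symm]
      simp
    refine ⟨eraseVertex E' w, splitField β γ E' c' w (X w) fun _ => X w, a * c' w (X w),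
      mul_pos ha hpos, hc'.splitField h w _ _, fun u hu n hn => ?_, fun u hu => ?_, fun x => ?_⟩
    · rw [Finset.mem_insert, not_or] at hu
      exact (hL u hu.2 n hn).splitField hu.1 _ _
    · rcases Finset.mem_insert.1 hu with rfl | hu
      · exact nbrs_eraseVertex_self E' u
      · exact Finset.subset_empty.1 (hiso u hu ▸ nbrs_eraseVertex_subset E' u w)
    · have := restrictSpin_fieldWeight (β := β) (γ := γ) E' hc'.not_isDiag c' w (X w) x
      rw [mul_assoc, ← this, restrictSpin, mul_ite, mul_zero, ← heq, ← ite_and]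
      simp only [Finset.forall_mem_insert]

end Pinning

/-! ### From mass functions to probability distributions -/

section Coupling

variable {V : Type*} [Fintype V] [DecidableEq V]

theorem TransportBound.iInf_expectedDist_le {μ ν : PMF (V → Bool)} {C : ℝ}
    (hT : TransportBound (fun x => (μ x).toReal) (fun x => (ν x).toReal) C) :
    (⨅ (ξ : PMF ((V → Bool) × (V → Bool))) (_ : IsCoupling μ ν ξ), expectedDist ξ) ≤
      ENNReal.ofReal C := by
  obtain ⟨ξ, h0, h1, h2, h3⟩ := hT
  have r1 : ∀ x, ∑ y, ENNReal.ofReal (ξ x y) = μ x := fun x => by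
    rw [← ENNReal.ofReal_sum_of_nonneg fun y _ => h0 x y, h1,
      ENNReal.ofReal_toReal (μ.apply_ne_top x)]
  have r2 : ∀ y, ∑ x, ENNReal.ofReal (ξ x y) = ν y := fun y => by
    rw [← ENNReal.ofReal_sum_of_nonneg fun x _ => h0 x y, h2,
      ENNReal.ofReal_toReal (ν.apply_ne_top y)]
  let P : PMF ((V → Bool) × (V → Bool)) :=
    PMF.ofFintype (fun p => ENNReal.ofReal (ξ p.1 p.2)) (by
      rw [Fintype.sum_prod_type]
      simp only [r1]
      exact (tsum_fintype _).symm.trans μ.tsum_coe)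
  have hP : IsCoupling μ ν P := by
    constructor
    · ext x
      rw [PMF.map_apply, tsum_fintype, Fintype.sum_prod_type]
      rw [Finset.sum_eq_single x (fun x' _ hx' => by simp [hx'.symm]) (by simp), ← r1 x]
      simp [P]
    · ext y
      rw [PMF.map_apply, tsum_fintype, Fintype.sum_prod_type]
      rw [← r2 y]
      refine Finset.sum_congr rfl fun x _ => ?_
      rw [Finset.sum_eq_single y (fun y' _ hy' => by simp [hy'.symm]) (by simp)]
      simp [P]
  refine (iInf₂_le P hP).trans ?_
  have e : expectedDist P =
      ENNReal.ofReal (∑ x, ∑ y, ξ x y * (hammingDist x y : ℝ)) := by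
    rw [expectedDist, tsum_fintype, Fintype.sum_prod_type,
      ENNReal.ofReal_sum_of_nonneg fun x _ => Finset.sum_nonneg fun y _ =>
        mul_nonneg (h0 x y) (Nat.cast_nonneg _)]
    refine Finset.sum_congr rfl fun x _ => ?_
    rw [ENNReal.ofReal_sum_of_nonneg fun y _ => mul_nonneg (h0 x y) (Nat.cast_nonneg _)]
    refine Finset.sum_congr rfl fun y _ => ?_
    rw [ENNReal.ofReal_mul (h0 x y), ENNReal.ofReal_natCast]
    rfl
  rw [e]
  exact ENNReal.ofReal_le_ofReal h3

variable (G : SimpleGraph V) [DecidableRel G.Adj] {β γ lam : ℝ}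

theorem weight_eq_fieldWeight (σ : V → Bool) :
    weight G β γ lam σ =
      fieldWeight β γ G.edgeFinset (fun _ t => if t = true then lam else 1) σ := by
  have hp : ∀ e : Sym2 V, pairFactor β γ σ e =
      (if ∀ v ∈ e, σ v = true then β else 1) * (if ∀ v ∈ e, σ v = false then γ else 1) :=
    fun e => by
      induction e using Sym2.ind with
      | _ a b =>
        rw [pairFactor_mk]
        cases ha : σ a <;> cases hb : σ b <;> simp [edgeFactor, ha, hb]
  simp only [weight, fieldWeight, hp, Finset.prod_mul_distrib, monoEdges, onesCount,
    Finset.prod_ite, Finset.prod_const, one_pow, mul_one]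

theorem IsAntiferro.weight_nonneg (h : IsAntiferro β γ lam) (σ : V → Bool) :
    0 ≤ weight G β γ lam σ := by
  have h1 := h.beta_nonneg
  have h2 := h.gamma_pos
  have h3 := h.lam_pos
  unfold weight
  positivity

/-- A configuration in the support of the Gibbs distribution extends each feasible pinning. -/
theorem exists_weight_pos (h : IsAntiferro β γ lam) {Λ : Finset V} {σ : Λ → Bool}
    (hσ : σ ∈ (marginal (gibbs G h) Λ).support) :
    ∃ X : V → Bool, Λ.restrict X = σ ∧ 0 < weight G β γ lam X := by
  obtain ⟨X, hX, hs⟩ := exists_mem_support_of_feasible hσ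
  refine ⟨X, hX, ?_⟩
  rw [gibbs, PMF.mem_support_normalize_iff] at hs
  simpa using hs

theorem toReal_pinned_gibbs (h : IsAntiferro β γ lam) {Λ : Finset V} {σ : Λ → Bool}
    (hσ : σ ∈ (marginal (gibbs G h) Λ).support) :
    (fun x => (pinned (gibbs G h) hσ x).toReal) =
      normalized fun x => if Λ.restrict x = σ then weight G β γ lam x else 0 := by
  set w' : (V → Bool) → ℝ := fun x => if Λ.restrict x = σ then weight G β γ lam x else 0
  have hw' : ∀ x, 0 ≤ w' x := fun x => by
    simp only [w']
    split_ifs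
    exacts [h.weight_nonneg G x, le_rfl]
  have hW0 := tsum_weight_ne_zero G h
  have hWt := tsum_weight_ne_top G β γ lam
  funext x
  set W := ∑' σ : V → Bool, ENNReal.ofReal (weight G β γ lam σ)
  have hind : ∀ y, Set.indicator {X | Λ.restrict X = σ} (gibbs G h) y =
      ENNReal.ofReal (w' y) * W⁻¹ := fun y => by
    by_cases hy : Λ.restrict y = σ
    · rw [Set.indicator_of_mem (show y ∈ {X | Λ.restrict X = σ} from hy), gibbs,
        PMF.normalize_apply]
      simp [w', hy, W]
    · rw [Set.indicator_of_notMem (show y ∉ {X | Λ.restrict X = σ} from hy)]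
      simp [w', hy]
  have hWr : (W⁻¹).toReal ≠ 0 := by
    rw [ENNReal.toReal_inv]
    exact inv_ne_zero (ENNReal.toReal_ne_zero.2 ⟨hW0, hWt⟩)
  rw [pinned, PMF.filter_apply]
  simp only [hind]
  rw [tsum_fintype, ← Finset.sum_mul, ← ENNReal.ofReal_sum_of_nonneg fun y _ => hw' y,
    ENNReal.toReal_mul, ENNReal.toReal_inv, ENNReal.toReal_mul, ENNReal.toReal_mul,
    ENNReal.toReal_ofReal (hw' x), ENNReal.toReal_ofReal (Finset.sum_nonneg fun y _ => hw' y),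
    normalized, ← div_eq_mul_inv, mul_div_mul_right _ _ hWr]

end Coupling

/-! ### Coupling independence -/

section Main

variable {V : Type*} [Fintype V] [DecidableEq V] (G : SimpleGraph V) [DecidableRel G.Adj]
  {β γ lam : ℝ}

theorem card_nbrs_edgeFinset (u : V) : (nbrs G.edgeFinset u).card = G.degree u := by
  rw [← G.card_neighborFinset_eq_degree]
  congr 1
  ext x
  simp [mem_nbrs]

/-- Flipping one pinned spin from `1` to `0`. -/
theorem transportBound_pinned (h : IsAntiferro β γ lam) {d : ℕ}
    (hdeg : ∀ u, G.degree u ≤ d + 1) (hreg : 1 < γ → G.IsRegularOfDegree (d + 1)) {x : ℝ}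
    (hx : 0 < x) (hfix : treeRec β γ lam d x = x) (hd : d * influence β γ x < 1)
    {Λ : Finset V} {σ τ : Λ → Bool} (hσ : σ ∈ (marginal (gibbs G h) Λ).support)
    (hτ : τ ∈ (marginal (gibbs G h) Λ).support) (v : Λ) (hσv : σ v = true) (hτv : τ v = false)
    (hne : ∀ u, u ≠ v → σ u = τ u) :
    TransportBound (fun x => (pinned (gibbs G h) hσ x).toReal)
      (fun x => (pinned (gibbs G h) hτ x).toReal)
      (1 + (d + 1) * (influence β γ x / (1 - d * influence β γ x))) := by
  have h3 := h.lam_pos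
  obtain ⟨X, hX, hXpos⟩ := exists_weight_pos G h hσ
  have hXv : X v = true := by rw [← hσv, ← hX]; rfl
  set c : V → Bool → ℝ := fun _ t => if t = true then lam else 1 with hcdef
  have hc : Admissible G.edgeFinset c := by
    refine ⟨fun e he => G.not_isDiag_of_mem_edgeFinset he, fun u t => ?_, fun u => Or.inl ?_⟩
    · cases t <;> simp [hcdef, h3.le]
    · simp [hcdef]
  have hlive : ∀ u, Live β γ lam G.edgeFinset c u (d + 1) := fun u =>
    ⟨0, 0, by simp [hcdef], by simp [hcdef], by simpa [card_nbrs_edgeFinset] using hdeg u,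
      fun hγ => by simpa [card_nbrs_edgeFinset] using hreg hγ u⟩
  obtain ⟨E', c', a, ha, hc', hL, hiso, heq⟩ := exists_pinned_system h hc (Λ.erase v) (X := X)
    (by rwa [← weight_eq_fieldWeight])
  have hR : Rooted β γ lam d E' c' v (d + 1) :=
    ⟨hc', hL _ (Finset.notMem_erase _ _) _ (hlive _), fun u _ hu => hL u (fun hmem => by
      rw [hiso u hmem] at hu
      simp at hu) _ (hlive u)⟩
  have hv1 : 0 < c' v true := by
    refine lt_of_le_of_ne (hc'.nonneg _ _) fun h0 => hXpos.ne' ?_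
    have := heq X
    rw [if_pos fun _ _ => rfl, ← weight_eq_fieldWeight] at this
    rw [this, fieldWeight, Finset.prod_eq_zero (Finset.mem_univ (v : V)) (by rw [hXv, ← h0])]
    simp
  -- conditioning on all of `Λ` is conditioning on `Λ \ {v}` followed by fixing the spin of `v`
  have hcond : ∀ ρ : Λ → Bool, (∀ u, u ≠ v → ρ u = σ u) →
      (fun y => if Λ.restrict y = ρ then weight G β γ lam y else 0) =
        fun y => a * restrictSpin (fieldWeight β γ E' c') v (ρ v) y := fun ρ hρ => by
    have hiff : ∀ y : V → Bool, Λ.restrict y = ρ ↔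
        y v = ρ v ∧ ∀ u ∈ Λ.erase (v : V), y u = X u := fun y => by
      have hXu : ∀ u : Λ, X u = σ u := fun u => by rw [← hX]; rfl
      constructor
      · rintro rfl
        refine ⟨rfl, fun u hu => ?_⟩
        rw [Finset.mem_erase] at hu
        have := hρ ⟨u, hu.2⟩ fun e => hu.1 (congrArg Subtype.val e)
        rw [← hXu] at this
        exact this
      · rintro ⟨h1, h2⟩
        funext u
        by_cases hu : u = v
        · rw [hu]; exact h1
        · rw [hρ u hu, ← hXu]
          exact h2 u (Finset.mem_erase.2 ⟨fun e => hu (Subtype.ext e), u.2⟩)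
    funext y
    rw [restrictSpin, mul_ite, mul_zero, ← heq, ← weight_eq_fieldWeight, ← ite_and]
    simp only [hiff]
  rw [toReal_pinned_gibbs, toReal_pinned_gibbs, hcond σ fun _ _ => rfl,
    hcond τ fun u hu => (hne u hu).symm, normalized_smul ha.ne', normalized_smul ha.ne', hσv, hτv]
  exact hR.transportBound h hx hfix hd hv1

end Main

end TwoSpin

theorem mainTheorem6 {V : Type*} [Fintype V] [DecidableEq V] (G : SimpleGraph V)
    [DecidableRel G.Adj] {β γ lam : ℝ} (h : TwoSpin.IsAntiferro β γ lam)
    (Δ : ℕ) (hΔ : 3 ≤ Δ) (hG : G.maxDegree = Δ) (δ : ℝ) (hδ : δ ∈ Set.Ioo (0 : ℝ) 1)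
    (hle : γ ≤ 1 → TwoSpin.IsUnique h (Δ - 1) δ)
    (hgt : 1 < γ → TwoSpin.IsUnique h (Δ - 1) δ ∧ G.IsRegularOfDegree Δ) :
    TwoSpin.CouplingIndependent (TwoSpin.gibbs G h)
      (1 + (Δ : ℝ) * (1 - δ) / (((Δ : ℝ) - 1) * δ)) := by
  obtain ⟨hδ0, hδ1⟩ := hδ
  obtain ⟨d, rfl⟩ : ∃ d, Δ = d + 1 := ⟨Δ - 1, by omega⟩
  have hu : TwoSpin.IsUnique h d δ := by
    rcases le_or_gt γ 1 with hγ | hγ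
    exacts [hle hγ, (hgt hγ).1]
  rw [TwoSpin.IsUnique, TwoSpin.abs_deriv_treeRec_fixedPoint] at hu
  set x := TwoSpin.fixedPoint h d
  have hx : 0 < x := TwoSpin.fixedPoint_pos h d
  have hslack : d * TwoSpin.influence β γ x ≤ 1 - δ := by
    rw [TwoSpin.influence, ← mul_div_assoc, ← mul_assoc]
    exact hu
  have hd0 : (0 : ℝ) < d := by exact_mod_cast (by omega : 0 < d)
  have hI := h.influence_nonneg hx.le
  have hC : 1 + ((d : ℝ) + 1) * (TwoSpin.influence β γ x / (1 - d * TwoSpin.influence β γ x)) ≤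
      1 + ((d + 1 : ℕ) : ℝ) * (1 - δ) / ((((d + 1 : ℕ) : ℝ) - 1) * δ) := by
    push_cast
    rw [add_sub_cancel_right, mul_div_assoc]
    gcongr 1 + (_ + 1) * ?_
    rw [div_le_div_iff₀ (by linarith) (by positivity)]
    nlinarith
  have hflip := @TwoSpin.transportBound_pinned V _ _ G _ β γ lam h d
    (fun u => hG ▸ G.degree_le_maxDegree u) (fun hγ => (hgt hγ).2) x hx
    (TwoSpin.treeRec_fixedPoint h d) (by linarith)
  intro Λ σ τ hσ hτ hdist
  obtain ⟨v, hv⟩ := Finset.card_eq_one.1 hdist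
  have hne : ∀ u, u ≠ v → σ u = τ u := fun u hu => by
    by_contra hne
    exact hu (Finset.mem_singleton.1 (hv ▸ Finset.mem_filter.2 ⟨Finset.mem_univ u, hne⟩))
  have hvne : σ v ≠ τ v :=
    (Finset.mem_filter.1 (hv.symm ▸ Finset.mem_singleton_self v : v ∈ _)).2
  refine TwoSpin.TransportBound.iInf_expectedDist_le (TwoSpin.TransportBound.mono ?_ hC)
  cases hσv : σ v
  · have hτv : τ v = true := by
      cases hτv : τ v
      · exact absurd (hσv.trans hτv.symm) hvne
      · rfl
    exact (hflip hτ hσ v hτv hσv fun u hu => (hne u hu).symm).symm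
  · have hτv : τ v = false := by
      cases hτv : τ v
      · rfl
      · exact absurd (hσv.trans hτv.symm) hvne
    exact hflip hσ hτ v hσv hτv hne
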